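/- **Theorem 1 (LVI-PDNN convergence).** Six azimuth thrusters have real moment arms $l_{ix},l_{iy}$, current thrusts $u_0\in\mathbb R^6$ and current angles $\alpha_0\in\mathbb R^6$. Let $\mathcal T(\alpha)\in\mathbb R^{3\times 6}$ be the configuration matrix with rows $(\cos\alpha_j)_j$, $(\sin\alpha_j)_j$ and $(l_{1x}\cos\alpha_1+l_{1y}\sin\alpha_1,\ -l_{2x}\cos\alpha_2+l_{2y}\sin\alpha_2,\ l_{3x}\cos\alpha_3-l_{3y}\sin\alpha_3,\ -l_{4x}\cos\alpha_4+l_{4y}\sin\alpha_4,\ l_{5x}\cos\alpha_5-l_{5y}\sin\alpha_5,\ -l_{6x}\cos\alpha_6-l_{6y}\sin\alpha_6)$. Let $\tau\in\mathbb R^3$ be the commanded generalized force, let $\mathcal Q,\mathcal P\in\mathbb R^{6\times 6}$ and $\mathcal R\in\mathbb R^{3\times 3}$ be symmetric positive definite weights, and let $\underline u,\overline u,\underline\alpha,\overline\alpha,\underline{\Delta\alpha},\overline{\Delta\alpha}\in\mathbb R^6$ and $\underline o,\overline o\in\mathbb R^3$ be bounds. Put $$K=\mathrm{diag}(2\mathcal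 Q,2\mathcal P,2\mathcal R),\quad W=\begin{bmatrix}2\mathcal Q^Tu_0\\0\\0\end{bmatrix},\quad M=\Big[\mathcal T(\alpha_0),\ \tfrac{\partial}{\partial\alpha}(\mathcal T(\alpha)u_0)\big|_{\alpha=\alpha_0},\ -I\Big],\quad Y=\tau-\mathcal T(\alpha_0)u_0,$$ $$\underline U=\begin{bmatrix}\underline u-u_0\\ \max(\underline\alpha-\alpha_0,\underline{\Delta\alpha})\\ \underline o\end{bmatrix},\qquad \overline U=\begin{bmatrix}\overline u-u_0\\ \min(\overline\alpha-\alpha_0,\overline{\Delta\alpha})\\ \overline o\end{bmatrix},$$ where max and min are taken componentwise. Assume that the locally convex quadratic program $$\min_{U\in\mathbb R^{15}}\ \tfrac12U^TKU+W^TU\quad\text{subject to}\quad MU=Y,\quad \underline U\le U\le\overline U$$ has an optimal solution $U^*$. For $\overline V\in\mathbb R^3$ let $$E=\begin{bmatrix}K&-M^T\\M&0\end{bmatrix},\qquad S=\begin{bmatrix}W\\-Y\end{bmatrix},\qquad \Omega_Z=\{(U,V)\in\mathbb R^{15}\times\mathbb R^3:\ \underline U\le U\le\overline U,\ -\overline V\le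 V\le\overline V\},$$ and let $G_{\Omega_Z}$ be the componentwise projection onto the box $\Omega_Z$. Then, for all sufficiently large $\overline V$ (componentwise at least some $V_0\in\mathbb R^3$ depending only on the quadratic program), the equation $G_{\Omega_Z}(Z-(EZ+S))=Z$ has a solution, and for every symmetric positive definite $\Gamma_Z\in\mathbb R^{18\times18}$ the dynamics $$\dot Z=\Gamma_Z(I+E^T)\{G_{\Omega_Z}(Z-(EZ+S))-Z\}$$ has a solution $Z=(U,V)$ on $[0,\infty)$ from every initial state $Z(0)\in\mathbb R^{18}$, and its output $U$ converges globally exponentially to $U^*$: there are $C,\lambda>0$, independent of the trajectory and of its initial state, such that for every solution $Z=(U,V)$ on $[0,\infty)$, every $Z^*$ with $G_{\Omega_Z}(Z^*-(EZ^*+S))=Z^*$ and every $t\ge0$, $$\|U(t)-U^*\|\le C\,\|Z(0)-Z^*\|\,e^{-\lambda t}.$$ -/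

import Mathlib

open Matrix

noncomputable section

namespace ThrustAllocation

/-- Indices of the decision vector `U = (Δu, Δα, o)`: six thrust increments, six angle increments
and three components of the allocation error. -/
abbrev UIdx : Type := Fin 6 ⊕ (Fin 6 ⊕ Fin 3)

/-- Indices of the primal-dual state `Z = (U, V)`. -/
abbrev ZIdx : Type := UIdx ⊕ Fin 3

/-- The Euclidean norm of a real vector. -/
def euclNorm {ι : Type*} [Fintype ι] (x : ι → ℝ) : ℝ := ‖WithLp.toLp 2 x‖

/-- The order box `{x | lo ≤ x ≤ hi}`. -/
def box {ι : Type*} (lo hi : ι → ℝ) : Set (ι → ℝ) := {x | ∀ i, lo i ≤ x i ∧ x i ≤ hi i}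

/-- The componentwise projection onto the box with bounds `lo` and `hi`. -/
def boxProj {ι : Type*} (lo hi x : ι → ℝ) : ι → ℝ := fun i =>
  if x i < lo i then lo i else if hi i < x i then hi i else x i

/-- The data of one step of the thrust allocation problem. -/
structure Data where
  /-- moment arms along the X direction -/
  lx : Fin 6 → ℝ
  /-- moment arms along the Y direction -/
  ly : Fin 6 → ℝ
  /-- current thrusts -/
  u0 : Fin 6 → ℝ
  /-- current angles -/
  α0 : Fin 6 → ℝ
  /-- commanded generalized force -/
  τ : Fin 3 → ℝ
  /-- weight of the power consumption -/
  Q : Matrix (Fin 6) (Fin 6) ℝ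
  /-- weight of the rotation of the thrusters -/
  P : Matrix (Fin 6) (Fin 6) ℝ
  /-- weight of the allocation error -/
  R : Matrix (Fin 3) (Fin 3) ℝ
  /-- bounds of the thrusts -/
  uLo : Fin 6 → ℝ
  uHi : Fin 6 → ℝ
  /-- bounds of the angles -/
  αLo : Fin 6 → ℝ
  αHi : Fin 6 → ℝ
  /-- bounds of the angle increments -/
  ΔαLo : Fin 6 → ℝ
  ΔαHi : Fin 6 → ℝ
  /-- bounds of the allocation error -/
  oLo : Fin 3 → ℝ
  oHi : Fin 3 → ℝ

namespace Data

variable (D : Data)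

/-- The thruster configuration matrix `T(α)`: `T(α) u` is the vector of the surge force, the sway
force and the yaw moment. -/
def T (α : Fin 6 → ℝ) : Matrix (Fin 3) (Fin 6) ℝ := Matrix.of
  ![fun j => Real.cos (α j),
    fun j => Real.sin (α j),
    ![ D.lx 0 * Real.cos (α 0) + D.ly 0 * Real.sin (α 0),
      -D.lx 1 * Real.cos (α 1) + D.ly 1 * Real.sin (α 1),
       D.lx 2 * Real.cos (α 2) - D.ly 2 * Real.sin (α 2),
      -D.lx 3 * Real.cos (α 3) + D.ly 3 * Real.sin (α 3),
       D.lx 4 * Real.cos (α 4) - D.ly 4 * Real.sin (α 4),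
      -D.lx 5 * Real.cos (α 5) - D.ly 5 * Real.sin (α 5)]]

/-- The Jacobian matrix of `α ↦ T(α) u₀` at `α₀`. -/
def J : Matrix (Fin 3) (Fin 6) ℝ := Matrix.of fun i j =>
  deriv (fun a => (D.T (Function.update D.α0 j a) *ᵥ D.u0) i) (D.α0 j)

/-- The Hessian `K = diag(2Q, 2P, 2R)`. -/
def K : Matrix UIdx UIdx ℝ :=
  fromBlocks ((2 : ℝ) • D.Q) 0 0 (fromBlocks ((2 : ℝ) • D.P) 0 0 ((2 : ℝ) • D.R))

/-- The linear term `W = (2 Qᵀ u₀, 0, 0)` of the cost. -/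
def W : UIdx → ℝ := Sum.elim (((2 : ℝ) • D.Qᵀ) *ᵥ D.u0) (Sum.elim 0 0)

/-- The matrix `M = [T(α₀), J, -I]` of the equality constraint. -/
def M : Matrix (Fin 3) UIdx ℝ := fromCols (D.T D.α0) (fromCols D.J (-1))

/-- The right-hand side `Y = τ - T(α₀) u₀` of the equality constraint. -/
def Y : Fin 3 → ℝ := D.τ - D.T D.α0 *ᵥ D.u0

/-- The lower bound of `U`. -/
def ULo : UIdx → ℝ :=
  Sum.elim (D.uLo - D.u0) (Sum.elim (fun j => max (D.αLo j - D.α0 j) (D.ΔαLo j)) D.oLo)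

/-- The upper bound of `U`. -/
def UHi : UIdx → ℝ :=
  Sum.elim (D.uHi - D.u0) (Sum.elim (fun j => min (D.αHi j - D.α0 j) (D.ΔαHi j)) D.oHi)

/-- The cost `½ Uᵀ K U + Wᵀ U`. -/
def cost (U : UIdx → ℝ) : ℝ := 1 / 2 * (U ⬝ᵥ (D.K *ᵥ U)) + D.W ⬝ᵥ U

/-- The feasible set of the quadratic program. -/
def feasible : Set (UIdx → ℝ) := {U | D.M *ᵥ U = D.Y ∧ U ∈ box D.ULo D.UHi}

/-- `U` is an optimal solution of the quadratic program. -/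
def IsOptimal (U : UIdx → ℝ) : Prop := U ∈ D.feasible ∧ ∀ U' ∈ D.feasible, D.cost U ≤ D.cost U'

/-- The block matrix `E` with rows `[K, -Mᵀ]` and `[M, 0]`. -/
def E : Matrix ZIdx ZIdx ℝ := fromBlocks D.K (-D.Mᵀ) D.M 0

/-- The vector `S = (W, -Y)`. -/
def S : ZIdx → ℝ := Sum.elim D.W (-D.Y)

/-- The projection onto `Ω_Z = {U | ULo ≤ U ≤ UHi} × {V | -Vbar ≤ V ≤ Vbar}`. -/
def G (Vbar : Fin 3 → ℝ) (Z : ZIdx → ℝ) : ZIdx → ℝ :=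
  boxProj (Sum.elim D.ULo (-Vbar)) (Sum.elim D.UHi Vbar) Z

/-- `Z` solves the projection equation `G(Z - (E Z + S)) - Z = 0`. -/
def IsEquilibrium (Vbar : Fin 3 → ℝ) (Z : ZIdx → ℝ) : Prop :=
  D.G Vbar (Z - (D.E *ᵥ Z + D.S)) - Z = 0

/-- The right-hand side `Γ (I + Eᵀ) (G(Z - (E Z + S)) - Z)` of the primal-dual neural dynamics. -/
def field (Vbar : Fin 3 → ℝ) (Γ : Matrix ZIdx ZIdx ℝ) (Z : ZIdx → ℝ) : ZIdx → ℝ :=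
  (Γ * (1 + D.Eᵀ)) *ᵥ (D.G Vbar (Z - (D.E *ᵥ Z + D.S)) - Z)

/-- `Z` solves the primal-dual neural dynamics on `[0, ∞)`. -/
def IsTrajectory (Vbar : Fin 3 → ℝ) (Γ : Matrix ZIdx ZIdx ℝ) (Z : ℝ → ZIdx → ℝ) : Prop :=
  ∀ t, 0 ≤ t → HasDerivWithinAt Z (D.field Vbar Γ (Z t)) (Set.Ici 0) t

end Data

/-- The output (primal part) `U` of a primal-dual state `Z = (U, V)`. -/
def output (Z : ZIdx → ℝ) : UIdx → ℝ := fun i => Z (Sum.inl i)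

end ThrustAllocation

end

/-! Zeros of the residual `e(Z) = G(Z - (E Z + S)) - Z` are the solutions of an affine variational
inequality over a box. The blocks `-Mᵀ` and `M` cancel in the quadratic form of `E`, which leaves
the form of `K` in `U`. So the inequality is monotone, and all its solutions share one `U`. KKT
multipliers `V` of the program make `(U*, V)` a solution once the box contains `V`, which also gives
existence.

For a solution `w`, the energy `(Z - w)ᵀ Γ⁻¹ (Z - w)` has derivative at most `-2 |e|²` along the
dynamics (`projResidual_dotProduct_le`, `hasDerivWithinAt_energy`). An exponential rate needs `|e|²`
to control the squared distance to the solution set (`exists_error_bound`). The residual is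
piecewise affine, so this follows from Hoffman's bound on each of finitely many polyhedral cells.
The infimum of the energy over all solutions then decays exponentially, and it dominates a multiple
of `|U - U*|²`, although `V` need not be unique.

Trajectories exist for all time because the field is globally Lipschitz. -/

/-! ### Finitely generated cones, Farkas' lemma and Hoffman's bound. -/

section Polyhedra

variable {J V : Type*} [Fintype J] [NormedAddCommGroup V] [InnerProductSpace ℝ V]

/-- **Carathéodory's theorem for cones.** -/
theorem exists_linearIndepOn_conic_eq (a : J → V) (s : Finset J) (l : J → ℝ)
    (hl : ∀ j, 0 ≤ l j) (hs : ∀ j, j ∉ s → l j = 0) :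
    ∃ t ⊆ s, ∃ m : J → ℝ, (∀ j, 0 ≤ m j) ∧ (∀ j, j ∉ t → m j = 0) ∧
      LinearIndepOn ℝ a (t : Set J) ∧ ∑ j, m j • a j = ∑ j, l j • a j := by
  classical
  induction s using Finset.strongInduction generalizing l with
  | H s ih =>
    by_cases hind : LinearIndepOn ℝ a (s : Set J)
    · exact ⟨s, subset_rfl, l, hl, hs, hind, rfl⟩
    obtain ⟨g, hg0, hgs, i, hgi⟩ : ∃ g : J → ℝ, ∑ j, g j • a j = 0 ∧ (∀ j, j ∉ s → g j = 0) ∧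
        ∃ i, 0 < g i := by
      rw [linearIndepOn_finset_iff] at hind
      push Not at hind
      obtain ⟨f, hf, i, hi, hfi⟩ := hind
      have hsum : ∑ j, (if j ∈ s then f j else 0) • a j = 0 := by
        rw [← hf]
        simp [ite_smul, Finset.sum_ite_mem]
      rcases lt_or_gt_of_ne hfi with h | h
      · refine ⟨fun j => -(if j ∈ s then f j else 0), ?_, ?_, i, ?_⟩
        · simpa [neg_smul, Finset.sum_neg_distrib] using hsum
        · intro j hj; simp [hj]
        · simpa [hi] using h
      · refine ⟨fun j => if j ∈ s then f j else 0, hsum, ?_, i, ?_⟩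
        · intro j hj; simp [hj]
        · simpa [hi] using h
    -- Ratio test: `l - (l k / g k) g` stays nonnegative, vanishes at `k`, and represents the same
    -- vector.
    obtain ⟨k, hk, hmin⟩ := Finset.exists_min_image (Finset.univ.filter fun j => 0 < g j)
      (fun j => l j / g j) ⟨i, by simpa using hgi⟩
    have hgk : 0 < g k := by simpa using hk
    have hks : k ∈ s := by
      by_contra h
      exact hgk.ne' (hgs k h)
    have hq : 0 ≤ l k / g k := div_nonneg (hl k) hgk.le
    obtain ⟨t, ht, m, hm0, hmt, hind', hsum⟩ := ih (s.erase k) (Finset.erase_ssubset hks)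
      (fun j => l j - l k / g k * g j)
      (by
        intro j
        by_cases hj : 0 < g j
        · have := hmin j (by simpa using hj)
          rw [le_div_iff₀ hj] at this
          linarith
        · have := mul_nonneg hq (neg_nonneg.2 (not_lt.1 hj))
          have := hl j
          linarith)
      (by
        intro j hj
        by_cases hjk : j = k
        · subst hjk
          field_simp
          ring
        · have hjs : j ∉ s := fun h => hj (Finset.mem_erase.2 ⟨hjk, h⟩)
          simp [hs j hjs, hgs j hjs])
    refine ⟨t, ht.trans (Finset.erase_subset _ _), m, hm0, hmt, hind', ?_⟩
    rw [hsum]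
    simp only [sub_smul, Finset.sum_sub_distrib, mul_smul, ← Finset.smul_sum, hg0, smul_zero,
      sub_zero]

/-- Coefficients on linearly independent subfamilies of a finite family are bounded by the norm of
the combination. -/
theorem exists_sum_le_mul_norm_of_linearIndepOn (a : J → V) :
    ∃ c : ℝ, 0 ≤ c ∧ ∀ (t : Finset J) (m : J → ℝ), LinearIndepOn ℝ a (t : Set J) →
      (∀ j, j ∉ t → m j = 0) → ∑ j, m j ≤ c * ‖∑ j, m j • a j‖ := by
  classical
  have key : ∀ t : Finset J, ∃ c : ℝ, 0 ≤ c ∧ ∀ m : J → ℝ, LinearIndepOn ℝ a (t : Set J) →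
      (∀ j, j ∉ t → m j = 0) → ∑ j, m j ≤ c * ‖∑ j, m j • a j‖ := by
    intro t
    by_cases hind : LinearIndepOn ℝ a (t : Set J)
    swap
    · exact ⟨0, le_rfl, fun m h => absurd h hind⟩
    let f : (t → ℝ) →ₗ[ℝ] V := Fintype.linearCombination ℝ fun j : t => a j
    have hker : LinearMap.ker f = ⊥ := by
      have : LinearIndependent ℝ fun j : t => a j := hind
      exact LinearMap.ker_eq_bot.2 (this.fintypeLinearCombination_injective)
    obtain ⟨K, -, hK⟩ := f.exists_antilipschitzWith hker
    refine ⟨(t.card : ℝ) * K, by positivity, fun m _ hm => ?_⟩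
    have hsum : ∑ j, m j = ∑ j : t, m j := by
      rw [Finset.sum_coe_sort t m]
      exact (Finset.sum_subset t.subset_univ fun j _ hj => hm j hj).symm
    have hsum' : ∑ j, m j • a j = f (fun j => m j) := by
      rw [Fintype.linearCombination_apply, Finset.sum_coe_sort t fun j => m j • a j]
      exact (Finset.sum_subset t.subset_univ fun j _ hj => by simp [hm j hj]).symm
    rw [hsum, hsum']
    have h1 : ‖fun j : t => m j‖ ≤ K * ‖f fun j => m j‖ := by
      have := hK.le_mul_dist (fun j : t => m j) 0
      simpa [dist_eq_norm] using this
    calc ∑ j : t, m j ≤ ∑ _j : t, ‖fun j : t => m j‖ :=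
          Finset.sum_le_sum fun j _ => (le_abs_self _).trans (norm_le_pi_norm (fun j : t => m j) j)
      _ = t.card * ‖fun j : t => m j‖ := by simp
      _ ≤ t.card * (K * ‖f fun j => m j‖) := by gcongr
      _ = _ := by ring
  choose c hc0 hc using key
  -- There are finitely many subsets, so summing their constants gives a uniform one.
  refine ⟨∑ t, c t, Finset.sum_nonneg fun t _ => hc0 t, fun t m hind hm => (hc t m hind hm).trans ?_⟩
  gcongr
  exact Finset.single_le_sum (fun t _ => hc0 t) (Finset.mem_univ t)

/-- Nonnegative combinations of a finite family can be rewritten with bounded coefficients and no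
larger support. -/
theorem exists_bounded_conic_eq (a : J → V) :
    ∃ c : ℝ, 0 ≤ c ∧ ∀ l : J → ℝ, (∀ j, 0 ≤ l j) → ∃ m : J → ℝ, (∀ j, 0 ≤ m j) ∧
      (∀ j, l j = 0 → m j = 0) ∧ ∑ j, m j • a j = ∑ j, l j • a j ∧
      ∑ j, m j ≤ c * ‖∑ j, l j • a j‖ := by
  classical
  obtain ⟨c, hc0, hc⟩ := exists_sum_le_mul_norm_of_linearIndepOn a
  refine ⟨c, hc0, fun l hl => ?_⟩
  obtain ⟨t, ht, m, hm0, hmt, hind, hsum⟩ := exists_linearIndepOn_conic_eq a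
    (Finset.univ.filter fun j => l j ≠ 0) l hl (by simp)
  refine ⟨m, hm0, fun j hj => hmt j fun hjt => ?_, hsum, hsum ▸ hc t m hind hmt⟩
  simpa [hj] using ht hjt

/-- A finitely generated convex cone is closed. -/
theorem isClosed_conic (a : J → V) :
    IsClosed {x : V | ∃ m : J → ℝ, (∀ j, 0 ≤ m j) ∧ ∑ j, m j • a j = x} := by
  classical
  obtain ⟨c, hc0, hc⟩ := exists_bounded_conic_eq a
  refine isClosed_of_closure_subset fun x hx => ?_
  -- Near `x` the coefficients can be chosen bounded, so locally the cone lies in a compact set of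
  -- combinations.
  have hcomp : IsCompact ((fun m : J → ℝ => ∑ j, m j • a j) ''
      Set.Icc 0 (fun _ => c * (‖x‖ + 1))) :=
    isCompact_Icc.image (by fun_prop)
  have hmem : x ∈ closure (Metric.ball x 1 ∩
      {x : V | ∃ m : J → ℝ, (∀ j, 0 ≤ m j) ∧ ∑ j, m j • a j = x}) :=
    Metric.isOpen_ball.inter_closure ⟨Metric.mem_ball_self one_pos, hx⟩
  have hsub : Metric.ball x 1 ∩ {x : V | ∃ m : J → ℝ, (∀ j, 0 ≤ m j) ∧ ∑ j, m j • a j = x} ⊆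
      (fun m : J → ℝ => ∑ j, m j • a j) '' Set.Icc 0 (fun _ => c * (‖x‖ + 1)) := by
    rintro y ⟨hy, l, hl, rfl⟩
    obtain ⟨m, hm0, -, hsum, hle⟩ := hc l hl
    refine ⟨m, ⟨hm0, fun j => ?_⟩, hsum⟩
    have h1 : m j ≤ ∑ j, m j := Finset.single_le_sum (fun j _ => hm0 j) (Finset.mem_univ j)
    refine h1.trans (hle.trans ?_)
    rw [Metric.mem_ball, dist_eq_norm] at hy
    have := norm_le_norm_add_norm_sub' (∑ j, l j • a j) x
    exact mul_le_mul_of_nonneg_left (by linarith) hc0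
  obtain ⟨m, hm, hmx⟩ := closure_minimal hsub hcomp.isClosed hmem
  exact ⟨m, hm.1, hmx⟩

/-- **Farkas' lemma** for a finite family of vectors. -/
theorem exists_conic_eq_of_forall_inner_nonpos [CompleteSpace V] (a : J → V) (b : V)
    (h : ∀ d : V, (∀ j, inner ℝ (a j) d ≤ 0) → inner ℝ b d ≤ 0) :
    ∃ m : J → ℝ, (∀ j, 0 ≤ m j) ∧ ∑ j, m j • a j = b := by
  classical
  set C : Set V := {x : V | ∃ m : J → ℝ, (∀ j, 0 ≤ m j) ∧ ∑ j, m j • a j = x}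
  have hconv : Convex ℝ C := by
    rintro x ⟨m, hm, rfl⟩ y ⟨l, hl, rfl⟩ p q hp hq -
    refine ⟨fun j => p * m j + q * l j,
      fun j => add_nonneg (mul_nonneg hp (hm j)) (mul_nonneg hq (hl j)), ?_⟩
    simp [add_smul, mul_smul, Finset.sum_add_distrib, Finset.smul_sum]
  have h0 : (0 : V) ∈ C := ⟨0, fun _ => le_rfl, by simp⟩
  -- With `v` the projection of `b` onto the cone, `b - v` is an admissible test direction; it
  -- forces `‖b - v‖² ≤ 0`.
  obtain ⟨v, hv, hmin⟩ := exists_norm_eq_iInf_of_complete_convex ⟨0, h0⟩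
    (isClosed_conic a).isComplete hconv b
  have hvi := (norm_eq_iInf_iff_real_inner_le_zero hconv hv).1 hmin
  obtain ⟨m, hm, hmv⟩ := hv
  have h1 : ∀ j, inner ℝ (a j) (b - v) ≤ 0 := by
    intro j
    have := hvi (v + a j) ⟨fun i => m i + if i = j then 1 else 0,
      fun i => add_nonneg (hm i) (by split_ifs <;> simp),
      by simp [add_smul, Finset.sum_add_distrib, hmv, ite_smul]⟩
    rwa [add_sub_cancel_left, real_inner_comm] at this
  have h2 : 0 ≤ inner ℝ (b - v) v := by
    have := hvi 0 h0
    simpa using this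
  have h3 := h (b - v) h1
  have h4 : inner ℝ (b - v) (b - v) ≤ 0 := by
    rw [inner_sub_left, real_inner_comm (b - v) v]
    linarith
  have h5 : b - v = 0 := by
    rwa [real_inner_self_nonpos] at h4
  exact ⟨m, hm, by rw [hmv, sub_eq_zero.1 h5]⟩

/-- The normal cone of a polyhedron at a point is generated by the active constraints. -/
theorem exists_multiplier_of_forall_inner_nonpos [CompleteSpace V] (a : J → V) (b : J → ℝ) (g y : V)
    (hy : ∀ j, inner ℝ (a j) y ≤ b j)
    (h : ∀ z : V, (∀ j, inner ℝ (a j) z ≤ b j) → inner ℝ g (z - y) ≤ 0) :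
    ∃ m : J → ℝ, (∀ j, 0 ≤ m j) ∧ (∀ j, inner ℝ (a j) y ≠ b j → m j = 0) ∧
      ∑ j, m j • a j = g := by
  classical
  obtain ⟨m, hm, hmg⟩ := exists_conic_eq_of_forall_inner_nonpos
    -- Inactive constraints are replaced by the zero vector; they have slack, so they survive a
    -- small step along `d`.
    (fun j => if inner ℝ (a j) y = b j then a j else 0) g (by
      intro d hd
      have hsmall : ∀ j, ∃ r : ℝ, 0 < r ∧ ∀ q, 0 ≤ q → q ≤ r → inner ℝ (a j) (y + q • d) ≤ b j := by
        intro j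
        simp only [inner_add_right, inner_smul_right]
        by_cases hj : inner ℝ (a j) y = b j
        · have := hd j
          simp only [hj, if_true] at this
          exact ⟨1, one_pos, fun q hq _ => by nlinarith⟩
        · have hlt := lt_of_le_of_ne (hy j) hj
          refine ⟨(b j - inner ℝ (a j) y) / (|inner ℝ (a j) d| + 1),
            div_pos (by linarith) (by positivity), fun q hq hqr => ?_⟩
          rw [le_div_iff₀ (by positivity)] at hqr
          have := mul_le_mul_of_nonneg_left (le_abs_self (inner ℝ (a j) d)) hq
          linarith
      choose r hr0 hr using hsmall
      obtain ⟨q, hq0, hq⟩ : ∃ q : ℝ, 0 < q ∧ ∀ j, q ≤ r j := by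
        obtain ⟨q, hq, hq0⟩ := ((Filter.eventually_all.2 fun j => Ioc_mem_nhdsGT (hr0 j)).and
          (self_mem_nhdsWithin (s := Set.Ioi (0 : ℝ)))).exists
        exact ⟨q, hq0, fun j => (hq j).2⟩
      have := h (y + q • d) fun j => hr j q hq0.le (hq j)
      rw [add_sub_cancel_left, inner_smul_right] at this
      exact nonpos_of_mul_nonpos_right this hq0)
  refine ⟨fun j => if inner ℝ (a j) y = b j then m j else 0, fun j => ?_, fun j hj => by simp [hj],
    ?_⟩
  · dsimp only
    split_ifs
    exacts [hm j, le_rfl]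
  · rw [← hmg]
    refine Finset.sum_congr rfl fun j _ => ?_
    by_cases hj : inner ℝ (a j) y = b j <;> simp [hj]

/-- **Hoffman's error bound** for a polyhedron. -/
theorem exists_hoffman_bound [FiniteDimensional ℝ V] (a : J → V) (b : J → ℝ)
    (hne : ∃ z : V, ∀ j, inner ℝ (a j) z ≤ b j) :
    ∃ c : ℝ, 0 ≤ c ∧ ∀ (x : V) (r : ℝ), 0 ≤ r → (∀ j, inner ℝ (a j) x ≤ b j + r) →
      ∃ y : V, (∀ j, inner ℝ (a j) y ≤ b j) ∧ ‖x - y‖ ≤ c * r := by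
  classical
  have : CompleteSpace V := FiniteDimensional.complete ℝ V
  obtain ⟨c, hc0, hc⟩ := exists_bounded_conic_eq a
  refine ⟨c, hc0, fun x r hr hx => ?_⟩
  set P : Set V := {z : V | ∀ j, inner ℝ (a j) z ≤ b j}
  have hconv : Convex ℝ P := by
    intro z hz w hw p q hp hq hpq j
    rw [inner_add_right, inner_smul_right, inner_smul_right]
    calc p * inner ℝ (a j) z + q * inner ℝ (a j) w ≤ p * b j + q * b j :=
          add_le_add (mul_le_mul_of_nonneg_left (hz j) hp) (mul_le_mul_of_nonneg_left (hw j) hq)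
      _ = b j := by rw [← add_mul, hpq, one_mul]
  have hclosed : IsClosed P := by
    have : P = ⋂ j, {z : V | inner ℝ (a j) z ≤ b j} := by ext; simp [P]
    rw [this]
    exact isClosed_iInter fun j => isClosed_le (by fun_prop) continuous_const
  obtain ⟨y, hy, hmin⟩ := exists_norm_eq_iInf_of_complete_convex hne hclosed.isComplete hconv x
  have hvi := (norm_eq_iInf_iff_real_inner_le_zero hconv hy).1 hmin
  refine ⟨y, hy, ?_⟩
  obtain ⟨l, hl, hact, hsum⟩ := exists_multiplier_of_forall_inner_nonpos a b (x - y) y hy hvi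
  -- Rewriting the multipliers with bounded coefficients makes the constant independent of `x`; the
  -- support does not grow, so they remain on active constraints.
  obtain ⟨m, hm, hml, hmsum, hmle⟩ := hc l hl
  rw [hsum] at hmsum hmle
  have h1 : ‖x - y‖ * ‖x - y‖ ≤ c * ‖x - y‖ * r := by
    calc ‖x - y‖ * ‖x - y‖ = inner ℝ (∑ j, m j • a j) (x - y) := by
          rw [hmsum, real_inner_self_eq_norm_mul_norm]
      _ = ∑ j, m j * inner ℝ (a j) (x - y) := by simp [sum_inner, inner_smul_left]
      _ ≤ ∑ j, m j * r := by
          refine Finset.sum_le_sum fun j _ => ?_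
          by_cases hj : inner ℝ (a j) y = b j
          · refine mul_le_mul_of_nonneg_left ?_ (hm j)
            rw [inner_sub_right, hj]
            linarith [hx j]
          · simp [hml j (hact j hj)]
      _ = (∑ j, m j) * r := by rw [Finset.sum_mul]
      _ ≤ c * ‖x - y‖ * r := by gcongr
  rcases (norm_nonneg (x - y)).eq_or_lt with h | h
  · rw [← h]; positivity
  · exact le_of_mul_le_mul_right (by linarith) h

end Polyhedra

/-! ### Error bound for affine variational inequalities over a box. -/

noncomputable section

section BoxVariationalInequality

namespace ThrustAllocation

variable {ι : Type*}

theorem boxProj_apply_eq_max_min {lo hi : ι → ℝ} (h : lo ≤ hi) (x : ι → ℝ) (i : ι) :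
    boxProj lo hi x i = max (lo i) (min (x i) (hi i)) := by
  have := h i
  unfold boxProj
  grind

theorem le_boxProj {lo hi : ι → ℝ} (h : lo ≤ hi) (x : ι → ℝ) (i : ι) :
    lo i ≤ boxProj lo hi x i := by
  rw [boxProj_apply_eq_max_min h]
  exact le_max_left _ _

theorem boxProj_le {lo hi : ι → ℝ} (h : lo ≤ hi) (x : ι → ℝ) (i : ι) :
    boxProj lo hi x i ≤ hi i := by
  rw [boxProj_apply_eq_max_min h]
  exact max_le (h i) (min_le_right _ _)

/-- The obtuse-angle inequality of a projection; a box is a product of intervals, so it holds in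
each coordinate. -/
theorem boxProj_variational {lo hi : ι → ℝ} (x y : ι → ℝ) (i : ι) (hl : lo i ≤ y i)
    (hh : y i ≤ hi i) : 0 ≤ (boxProj lo hi x i - x i) * (y i - boxProj lo hi x i) := by
  unfold boxProj
  split_ifs with h1 h2
  · exact mul_nonneg (by linarith) (by linarith)
  · exact mul_nonneg_of_nonpos_of_nonpos (by linarith) (by linarith)
  · simp

variable [Fintype ι]

theorem lipschitzWith_boxProj {lo hi : ι → ℝ} (h : lo ≤ hi) :
    LipschitzWith 1 (boxProj lo hi) := by
  refine LipschitzWith.of_dist_le_mul fun x y => ?_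
  rw [NNReal.coe_one, one_mul, dist_pi_le_iff dist_nonneg]
  intro i
  refine le_trans ?_ (dist_le_pi_dist x y i)
  rw [boxProj_apply_eq_max_min h, boxProj_apply_eq_max_min h, Real.dist_eq, Real.dist_eq]
  grind

/-- The residual of the projection equation of the affine variational inequality with the map
`Z ↦ E Z + S` over the box with bounds `lo` and `hi`. -/
def projResidual (lo hi : ι → ℝ) (E : Matrix ι ι ℝ) (S Z : ι → ℝ) : ι → ℝ :=
  boxProj lo hi (Z - (E *ᵥ Z + S)) - Z

theorem exists_lipschitzWith_projResidual {lo hi : ι → ℝ} (h : lo ≤ hi) (E : Matrix ι ι ℝ)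
    (S : ι → ℝ) : ∃ K, LipschitzWith K (projResidual lo hi E S) := by
  have h1 := (LinearMap.toContinuousLinearMap E.mulVecLin).lipschitz
  have h2 : LipschitzWith _ fun Z : ι → ℝ => Z - (E *ᵥ Z + S) :=
    LipschitzWith.id.sub (h1.add (LipschitzWith.const S))
  exact ⟨_, ((lipschitzWith_boxProj h).comp h2).sub LipschitzWith.id⟩

/-- The residual of a monotone affine variational inequality is a direction of descent for the
distance to each solution. -/
theorem projResidual_dotProduct_le {lo hi : ι → ℝ} (h : lo ≤ hi) (E : Matrix ι ι ℝ) (S Z w : ι → ℝ)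
    (hw : projResidual lo hi E S w = 0) :
    projResidual lo hi E S Z ⬝ᵥ projResidual lo hi E S Z + (Z - w) ⬝ᵥ (E *ᵥ (Z - w)) ≤
      -(((Z - w) + E *ᵥ (Z - w)) ⬝ᵥ projResidual lo hi E S Z) := by
  set e := projResidual lo hi E S Z with he
  have hp : boxProj lo hi (Z - (E *ᵥ Z + S)) = e + Z := by simp [he, projResidual]
  have hpw : boxProj lo hi (w - (E *ᵥ w + S)) = w := sub_eq_zero.1 hw
  -- Sum of two variational inequalities: the one at the projection tested with `w`, and the one at
  -- `w` tested with the projection.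
  have key : 0 ≤ ∑ i, ((E *ᵥ Z) i - (E *ᵥ w) i + e i) * (w i - (e i + Z i)) := by
    refine Finset.sum_nonneg fun i _ => ?_
    have hwl : lo i ≤ w i := hpw ▸ le_boxProj h _ i
    have hwh : w i ≤ hi i := hpw ▸ boxProj_le h _ i
    have h1 := boxProj_variational (Z - (E *ᵥ Z + S)) w i hwl hwh
    have h2 := boxProj_variational (w - (E *ᵥ w + S)) (e + Z) i
      (hp ▸ le_boxProj h _ i) (hp ▸ boxProj_le h _ i)
    rw [hp] at h1
    rw [hpw] at h2
    simp only [Pi.add_apply, Pi.sub_apply] at h1 h2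
    linarith
  have : ∑ i, ((E *ᵥ Z) i - (E *ᵥ w) i + e i) * (w i - (e i + Z i)) =
      -(((Z - w) + E *ᵥ (Z - w)) ⬝ᵥ e) - (e ⬝ᵥ e + (Z - w) ⬝ᵥ (E *ᵥ (Z - w))) := by
    simp only [dotProduct, mulVec_sub, ← Finset.sum_add_distrib, ← Finset.sum_neg_distrib,
      ← Finset.sum_sub_distrib, Pi.add_apply, Pi.sub_apply]
    exact Finset.sum_congr rfl fun i _ => by ring
  linarith

theorem sq_apply_le_dotProduct_self (x : ι → ℝ) (i : ι) : x i * x i ≤ x ⬝ᵥ x :=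
  Finset.single_le_sum (f := fun i => x i * x i) (fun i _ => mul_self_nonneg (x i))
    (Finset.mem_univ i)

/-- **Hoffman's error bound** in coordinates. -/
theorem exists_hoffman_bound_dotProduct {J : Type*} [Fintype J] (a : J → ι → ℝ) (b : J → ℝ)
    (hne : ∃ z : ι → ℝ, ∀ j, a j ⬝ᵥ z ≤ b j) :
    ∃ c : ℝ, 0 ≤ c ∧ ∀ (x : ι → ℝ) (r : ℝ), 0 ≤ r → (∀ j, a j ⬝ᵥ x ≤ b j + r) →
      ∃ y : ι → ℝ, (∀ j, a j ⬝ᵥ y ≤ b j) ∧ (x - y) ⬝ᵥ (x - y) ≤ c * r ^ 2 := by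
  have hin : ∀ x y : ι → ℝ, inner ℝ (WithLp.toLp 2 x : EuclideanSpace ℝ ι) (WithLp.toLp 2 y) =
      x ⬝ᵥ y := fun x y => by
    rw [EuclideanSpace.inner_toLp_toLp, dotProduct_comm]; simp
  obtain ⟨z, hz⟩ := hne
  obtain ⟨c, hc0, hc⟩ := exists_hoffman_bound
    (fun j => (WithLp.toLp 2 (a j) : EuclideanSpace ℝ ι)) b
    ⟨WithLp.toLp 2 z, fun j => (hin _ _).trans_le (hz j)⟩
  refine ⟨c ^ 2, by positivity, fun x r hr hx => ?_⟩
  obtain ⟨y, hy, hxy⟩ := hc (WithLp.toLp 2 x) r hr fun j => (hin _ _).trans_le (hx j)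
  refine ⟨y.ofLp, fun j => (hin _ _).symm.trans_le (hy j), ?_⟩
  rw [← hin, WithLp.toLp_sub, real_inner_self_eq_norm_sq, ← mul_pow]
  exact pow_le_pow_left₀ (norm_nonneg _) hxy 2

variable (lo hi : ι → ℝ) (E : Matrix ι ι ℝ) (S : ι → ℝ)

/-- The region where the projection in the residual is constant equal to the lower bound, is the
identity, or is constant equal to the upper bound, as prescribed for each coordinate. -/
def cell (σ : ι → Fin 3) : Set (ι → ℝ) :=
  {Z | ∀ i, ![Z i - ((E *ᵥ Z) i + S i) ≤ lo i,
    lo i ≤ Z i - ((E *ᵥ Z) i + S i) ∧ Z i - ((E *ᵥ Z) i + S i) ≤ hi i,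
    hi i ≤ Z i - ((E *ᵥ Z) i + S i)] (σ i)}

theorem isClosed_cell (σ : ι → Fin 3) : IsClosed (cell lo hi E S σ) := by
  simp only [cell, Set.ofPred_forall]
  refine isClosed_iInter fun i => ?_
  have hc : Continuous fun Z : ι → ℝ => Z i - ((E *ᵥ Z) i + S i) := by
    have : Continuous fun Z : ι → ℝ => E *ᵥ Z := by fun_prop
    have := (continuous_apply i).comp this
    exact (continuous_apply i).sub (this.add continuous_const)
  rcases hσ : σ i with ⟨_ | _ | _ | k, hk⟩
  · exact isClosed_le hc continuous_const
  · exact (isClosed_le continuous_const hc).inter (isClosed_le hc continuous_const)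
  · exact isClosed_le continuous_const hc
  · omega

theorem exists_mem_cell (Z : ι → ℝ) : ∃ σ, Z ∈ cell lo hi E S σ := by
  have : ∀ i, ∃ s : Fin 3, ![Z i - ((E *ᵥ Z) i + S i) ≤ lo i,
      lo i ≤ Z i - ((E *ᵥ Z) i + S i) ∧ Z i - ((E *ᵥ Z) i + S i) ≤ hi i,
      hi i ≤ Z i - ((E *ᵥ Z) i + S i)] s := by
    intro i
    rcases le_total (Z i - ((E *ᵥ Z) i + S i)) (lo i) with h | h
    · exact ⟨0, h⟩
    rcases le_total (Z i - ((E *ᵥ Z) i + S i)) (hi i) with h' | h'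
    · exact ⟨1, h, h'⟩
    · exact ⟨2, h'⟩
  choose σ hσ using this
  exact ⟨σ, hσ⟩

variable {lo hi}

theorem projResidual_of_mem_cell (h : lo ≤ hi) {σ : ι → Fin 3} {Z : ι → ℝ}
    (hZ : Z ∈ cell lo hi E S σ) (i : ι) :
    projResidual lo hi E S Z i =
      ![lo i - Z i, -((E *ᵥ Z) i + S i), hi i - Z i] (σ i) := by
  have h1 := hZ i
  have h2 := h i
  simp only [projResidual, Pi.sub_apply, boxProj_apply_eq_max_min h, Pi.add_apply]
  rcases hσ : σ i with ⟨_ | _ | _ | k, hk⟩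
  · rw [hσ] at h1
    change Z i - ((E *ᵥ Z) i + S i) ≤ lo i at h1
    change _ = lo i - Z i
    rw [min_eq_left (h1.trans h2), max_eq_left h1]
  · rw [hσ] at h1
    change lo i ≤ Z i - ((E *ᵥ Z) i + S i) ∧ Z i - ((E *ᵥ Z) i + S i) ≤ hi i at h1
    change _ = -((E *ᵥ Z) i + S i)
    rw [min_eq_left h1.2, max_eq_right h1.1]
    ring
  · rw [hσ] at h1
    change hi i ≤ Z i - ((E *ᵥ Z) i + S i) at h1
    change _ = hi i - Z i
    rw [min_eq_right h1, max_eq_right h2]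
  · omega

/-- The residual is bounded away from zero on a closed set without solutions. -/
theorem exists_pos_le_projResidual_of_isClosed (h : lo ≤ hi) {A : Set (ι → ℝ)} (hA : IsClosed A)
    (hA0 : ∀ Z ∈ A, projResidual lo hi E S Z ≠ 0) :
    ∃ ε : ℝ, 0 < ε ∧ ∀ Z ∈ A, ε ≤ projResidual lo hi E S Z ⬝ᵥ projResidual lo hi E S Z := by
  obtain ⟨K, hK⟩ := exists_lipschitzWith_projResidual h E S
  have hcont : Continuous fun Z => projResidual lo hi E S Z ⬝ᵥ projResidual lo hi E S Z :=
    hK.continuous.dotProduct hK.continuous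
  -- The projection lies in the box, so outside the box enlarged by 1 some coordinate of the
  -- residual exceeds 1 in modulus.
  have hfar : ∀ Z, Z ∉ Set.Icc (lo - 1) (hi + 1) →
      1 ≤ projResidual lo hi E S Z ⬝ᵥ projResidual lo hi E S Z := by
    intro Z hZ
    by_contra! hlt
    refine hZ ⟨fun i => ?_, fun i => ?_⟩
    all_goals
      have h1 := (sq_apply_le_dotProduct_self (projResidual lo hi E S Z) i).trans_lt hlt
      have h2 := le_boxProj h (Z - (E *ᵥ Z + S)) i
      have h3 := boxProj_le h (Z - (E *ᵥ Z + S)) i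
      have h4 : projResidual lo hi E S Z i = boxProj lo hi (Z - (E *ᵥ Z + S)) i - Z i := rfl
      have h5 := abs_lt.1 ((sq_lt_one_iff_abs_lt_one (projResidual lo hi E S Z i)).1 (by rwa [sq]))
    · rw [Pi.sub_apply, Pi.one_apply]
      linarith
    · rw [Pi.add_apply, Pi.one_apply]
      linarith
  by_cases hne : (A ∩ Set.Icc (lo - 1) (hi + 1)).Nonempty
  · obtain ⟨Z0, hZ0, hmin⟩ := (isCompact_Icc.inter_left hA).exists_isMinOn hne hcont.continuousOn
    refine ⟨min 1 (projResidual lo hi E S Z0 ⬝ᵥ projResidual lo hi E S Z0), lt_min one_pos ?_,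
      fun Z hZ => ?_⟩
    · exact lt_of_le_of_ne (Finset.sum_nonneg fun i _ => mul_self_nonneg _)
        fun h0 => hA0 Z0 hZ0.1 (dotProduct_self_eq_zero.1 h0.symm)
    · by_cases hZI : Z ∈ Set.Icc (lo - 1) (hi + 1)
      · exact (min_le_right _ _).trans (hmin ⟨hZ, hZI⟩)
      · exact (min_le_left _ _).trans (hfar Z hZI)
  · exact ⟨1, one_pos, fun Z hZ => hfar Z fun hZI => hne ⟨Z, hZ, hZI⟩⟩

/-- The residual is affine on a cell, so the solutions there form a polyhedron and Hoffman's bound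
applies. In a cell without solutions the residual is bounded below, and any solution serves as `w`.
-/
theorem exists_error_bound_on_cell (h : lo ≤ hi) (hne : ∃ w, projResidual lo hi E S w = 0)
    (σ : ι → Fin 3) :
    ∃ c : ℝ, 0 ≤ c ∧ ∀ Z ∈ cell lo hi E S σ, ∃ w, projResidual lo hi E S w = 0 ∧
      (Z - w) ⬝ᵥ (Z - w) ≤ c * (projResidual lo hi E S Z ⬝ᵥ projResidual lo hi E S Z) := by
  classical
  by_cases hσ : ∃ w ∈ cell lo hi E S σ, projResidual lo hi E S w = 0
  · let p : ι → ι → ℝ := fun i => Pi.single i 1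
    have hp : ∀ i Z, p i ⬝ᵥ Z = Z i := fun i Z => by simp [p]
    have hE : ∀ i Z, E i ⬝ᵥ Z = (E *ᵥ Z) i := fun i Z => rfl
    -- Per coordinate, rows 0 and 1 describe the cell (one inequality repeated on the outer cells),
    -- and rows 2 and 3 say that the residual vanishes.
    let a : ι × Fin 4 → ι → ℝ := fun k =>
      ![![p k.1 - E k.1, p k.1 - E k.1, p k.1, -p k.1],
        ![p k.1 - E k.1, -(p k.1 - E k.1), E k.1, -E k.1],
        ![-(p k.1 - E k.1), -(p k.1 - E k.1), p k.1, -p k.1]] (σ k.1) k.2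
    let b : ι × Fin 4 → ℝ := fun k =>
      ![![lo k.1 + S k.1, lo k.1 + S k.1, lo k.1, -lo k.1],
        ![hi k.1 + S k.1, -(lo k.1 + S k.1), -S k.1, S k.1],
        ![-(hi k.1 + S k.1), -(hi k.1 + S k.1), hi k.1, -hi k.1]] (σ k.1) k.2
    have hsol : ∀ Z, (∀ k, a k ⬝ᵥ Z ≤ b k) → Z ∈ cell lo hi E S σ ∧ projResidual lo hi E S Z = 0 := by
      intro Z hZ
      have hmem : Z ∈ cell lo hi E S σ := by
        intro i
        have h0 := hZ (i, 0)
        have h1 := hZ (i, 1)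
        simp only [a, b] at h0 h1
        rcases hi' : σ i with ⟨_ | _ | _ | k, hk⟩
        · rw [hi'] at h0
          change (p i - E i) ⬝ᵥ Z ≤ lo i + S i at h0
          change Z i - ((E *ᵥ Z) i + S i) ≤ lo i
          rw [sub_dotProduct, hp, hE] at h0
          linarith
        · rw [hi'] at h0 h1
          change (p i - E i) ⬝ᵥ Z ≤ hi i + S i at h0
          change -(p i - E i) ⬝ᵥ Z ≤ -(lo i + S i) at h1
          change lo i ≤ Z i - ((E *ᵥ Z) i + S i) ∧ Z i - ((E *ᵥ Z) i + S i) ≤ hi i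
          rw [sub_dotProduct, hp, hE] at h0
          rw [neg_dotProduct, sub_dotProduct, hp, hE] at h1
          constructor <;> linarith
        · rw [hi'] at h0
          change -(p i - E i) ⬝ᵥ Z ≤ -(hi i + S i) at h0
          change hi i ≤ Z i - ((E *ᵥ Z) i + S i)
          rw [neg_dotProduct, sub_dotProduct, hp, hE] at h0
          linarith
        · omega
      refine ⟨hmem, funext fun i => ?_⟩
      rw [projResidual_of_mem_cell E S h hmem]
      have h2 := hZ (i, 2)
      have h3 := hZ (i, 3)
      simp only [a, b] at h2 h3
      rcases hi' : σ i with ⟨_ | _ | _ | k, hk⟩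
      · rw [hi'] at h2 h3
        change p i ⬝ᵥ Z ≤ lo i at h2
        change -p i ⬝ᵥ Z ≤ -lo i at h3
        rw [hp] at h2
        rw [neg_dotProduct, hp] at h3
        change lo i - Z i = 0
        linarith
      · rw [hi'] at h2 h3
        change E i ⬝ᵥ Z ≤ -S i at h2
        change -E i ⬝ᵥ Z ≤ S i at h3
        rw [hE] at h2
        rw [neg_dotProduct, hE] at h3
        change -((E *ᵥ Z) i + S i) = 0
        linarith
      · rw [hi'] at h2 h3
        change p i ⬝ᵥ Z ≤ hi i at h2
        change -p i ⬝ᵥ Z ≤ -hi i at h3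
        rw [hp] at h2
        rw [neg_dotProduct, hp] at h3
        change hi i - Z i = 0
        linarith
      · omega
    have happrox : ∀ Z ∈ cell lo hi E S σ, ∀ r, 0 ≤ r → (∀ i, |projResidual lo hi E S Z i| ≤ r) →
        ∀ k, a k ⬝ᵥ Z ≤ b k + r := by
      rintro Z hZ r hr hres ⟨i, k⟩
      have h1 := hres i
      rw [projResidual_of_mem_cell E S h hZ] at h1
      have h2 := hZ i
      simp only [a, b]
      rcases hi' : σ i with ⟨_ | _ | _ | m, hm⟩
      · rw [hi'] at h1 h2
        change Z i - ((E *ᵥ Z) i + S i) ≤ lo i at h2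
        change |lo i - Z i| ≤ r at h1
        rw [abs_le] at h1
        fin_cases k
        · change (p i - E i) ⬝ᵥ Z ≤ lo i + S i + r
          rw [sub_dotProduct, hp, hE]
          linarith
        · change (p i - E i) ⬝ᵥ Z ≤ lo i + S i + r
          rw [sub_dotProduct, hp, hE]
          linarith
        · change p i ⬝ᵥ Z ≤ lo i + r
          rw [hp]
          linarith
        · change -p i ⬝ᵥ Z ≤ -lo i + r
          rw [neg_dotProduct, hp]
          linarith
      · rw [hi'] at h1 h2
        change lo i ≤ Z i - ((E *ᵥ Z) i + S i) ∧ Z i - ((E *ᵥ Z) i + S i) ≤ hi i at h2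
        change |-((E *ᵥ Z) i + S i)| ≤ r at h1
        rw [abs_le] at h1
        fin_cases k
        · change (p i - E i) ⬝ᵥ Z ≤ hi i + S i + r
          rw [sub_dotProduct, hp, hE]
          linarith
        · change -(p i - E i) ⬝ᵥ Z ≤ -(lo i + S i) + r
          rw [neg_dotProduct, sub_dotProduct, hp, hE]
          linarith
        · change E i ⬝ᵥ Z ≤ -S i + r
          rw [hE]
          linarith
        · change -E i ⬝ᵥ Z ≤ S i + r
          rw [neg_dotProduct, hE]
          linarith
      · rw [hi'] at h1 h2
        change hi i ≤ Z i - ((E *ᵥ Z) i + S i) at h2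
        change |hi i - Z i| ≤ r at h1
        rw [abs_le] at h1
        fin_cases k
        · change -(p i - E i) ⬝ᵥ Z ≤ -(hi i + S i) + r
          rw [neg_dotProduct, sub_dotProduct, hp, hE]
          linarith
        · change -(p i - E i) ⬝ᵥ Z ≤ -(hi i + S i) + r
          rw [neg_dotProduct, sub_dotProduct, hp, hE]
          linarith
        · change p i ⬝ᵥ Z ≤ hi i + r
          rw [hp]
          linarith
        · change -p i ⬝ᵥ Z ≤ -hi i + r
          rw [neg_dotProduct, hp]
          linarith
      · omega
    obtain ⟨w0, hw0, hw0r⟩ := hσ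
    obtain ⟨c, hc0, hc⟩ := exists_hoffman_bound_dotProduct a b
      ⟨w0, fun k => by simpa using happrox w0 hw0 0 le_rfl (by simp [hw0r]) k⟩
    refine ⟨c, hc0, fun Z hZ => ?_⟩
    have hnn : 0 ≤ projResidual lo hi E S Z ⬝ᵥ projResidual lo hi E S Z :=
      Finset.sum_nonneg fun i _ => mul_self_nonneg _
    obtain ⟨w, hw, hle⟩ := hc Z (Real.sqrt (projResidual lo hi E S Z ⬝ᵥ projResidual lo hi E S Z))
      (Real.sqrt_nonneg _) (happrox Z hZ _ (Real.sqrt_nonneg _) fun i =>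
        Real.abs_le_sqrt (by rw [sq]; exact sq_apply_le_dotProduct_self _ i))
    refine ⟨w, (hsol w hw).2, ?_⟩
    rwa [Real.sq_sqrt hnn] at hle
  · obtain ⟨w, hw⟩ := hne
    obtain ⟨ε, hε, hle⟩ := exists_pos_le_projResidual_of_isClosed E S h (isClosed_cell lo hi E S σ)
      fun Z hZ h0 => hσ ⟨Z, hZ, h0⟩
    set D := (hi - lo) ⬝ᵥ (hi - lo) with hD
    have hD0 : 0 ≤ D := Finset.sum_nonneg fun i _ => mul_self_nonneg _
    -- From `|Z - w|² ≤ 2 D + 2 |e|²`, where `D` is the squared diagonal of the box, and `ε ≤ |e|²`.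
    refine ⟨2 * D / ε + 2, by positivity, fun Z hZ => ⟨w, hw, ?_⟩⟩
    set e := projResidual lo hi E S Z with he
    have h1 : (Z - w) ⬝ᵥ (Z - w) ≤ 2 * D + 2 * (e ⬝ᵥ e) := by
      simp only [hD, dotProduct, Finset.mul_sum, ← Finset.sum_add_distrib]
      refine Finset.sum_le_sum fun i _ => ?_
      have hpw : boxProj lo hi (w - (E *ᵥ w + S)) = w := sub_eq_zero.1 hw
      have h2 := le_boxProj h (Z - (E *ᵥ Z + S)) i
      have h3 := boxProj_le h (Z - (E *ᵥ Z + S)) i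
      have h4 : e i = boxProj lo hi (Z - (E *ᵥ Z + S)) i - Z i := rfl
      have hwl : lo i ≤ w i := hpw ▸ le_boxProj h _ i
      have hwh : w i ≤ hi i := hpw ▸ boxProj_le h _ i
      simp only [Pi.sub_apply]
      set q := boxProj lo hi (Z - (E *ᵥ Z + S)) i
      have h5 : Z i - w i = (q - w i) - e i := by rw [h4]; ring
      have h6 : (q - w i) ^ 2 ≤ (hi i - lo i) ^ 2 := sq_le_sq' (by linarith) (by linarith)
      rw [h5]
      nlinarith [sq_nonneg ((q - w i) + e i)]
    have h2 : 2 * D ≤ 2 * D / ε * (e ⬝ᵥ e) := by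
      rw [div_mul_eq_mul_div, le_div_iff₀ hε]
      exact mul_le_mul_of_nonneg_left (hle Z hZ) (by positivity)
    linarith

/-- The distance to the solution set of an affine variational inequality over a box is bounded by
the residual. -/
theorem exists_error_bound (h : lo ≤ hi) (hne : ∃ w, projResidual lo hi E S w = 0) :
    ∃ c : ℝ, 0 < c ∧ ∀ Z, ∃ w, projResidual lo hi E S w = 0 ∧
      (Z - w) ⬝ᵥ (Z - w) ≤ c * (projResidual lo hi E S Z ⬝ᵥ projResidual lo hi E S Z) := by
  classical
  choose c hc0 hc using exists_error_bound_on_cell E S h hne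
  refine ⟨∑ σ, c σ + 1, by linarith [Finset.sum_nonneg fun σ (_ : σ ∈ Finset.univ) => hc0 σ],
    fun Z => ?_⟩
  obtain ⟨σ, hσ⟩ := exists_mem_cell lo hi E S Z
  obtain ⟨w, hw, hle⟩ := hc σ Z hσ
  refine ⟨w, hw, hle.trans (mul_le_mul_of_nonneg_right ?_
    (Finset.sum_nonneg fun i _ => mul_self_nonneg _))⟩
  linarith [Finset.single_le_sum (fun σ _ => hc0 σ) (Finset.mem_univ σ)]

end ThrustAllocation

end BoxVariationalInequality
end

/-! ### Global solutions of Lipschitz autonomous equations. -/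

section GlobalExistence

variable {F : Type*} [NormedAddCommGroup F] [NormedSpace ℝ F]

/-- Solutions of an autonomous equation on consecutive intervals of the same length combine to a
solution on the half-line. -/
theorem hasDerivWithinAt_Ici_of_forall_Icc {f : F → F} {Z : ℝ → F} {ε : ℝ} (hε : 0 < ε)
    (h : ∀ n : ℕ, ∀ t ∈ Set.Icc (n * ε) ((n + 1) * ε),
      HasDerivWithinAt Z (f (Z t)) (Set.Icc (n * ε) ((n + 1) * ε)) t)
    {t : ℝ} (ht : 0 ≤ t) : HasDerivWithinAt Z (f (Z t)) (Set.Ici 0) t := by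
  have hIcc : ∀ n : ℕ, ∀ s ∈ Set.Icc 0 ((n + 1) * ε),
      HasDerivWithinAt Z (f (Z s)) (Set.Icc 0 ((n + 1) * ε)) s := by
    intro n
    induction n with
    | zero => simpa using h 0
    | succ n ih =>
      have h1 : (0 : ℝ) ≤ (n + 1) * ε := by positivity
      have h2 : (n + 1) * ε ≤ ((n + 1 : ℕ) + 1) * ε := by
        push_cast
        nlinarith
      intro s hs
      rw [← Set.Icc_union_Icc_eq_Icc h1 h2]
      refine HasDerivWithinAt.union ?_ ?_
      · by_cases hs1 : s ∈ Set.Icc 0 ((n + 1) * ε)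
        · exact ih s hs1
        -- Away from the closure of the interval, the derivative condition is vacuous.
        · exact HasFDerivWithinAt.of_notMem_closure (by rwa [isClosed_Icc.closure_eq])
      · have h3 := h (n + 1) s
        push_cast at h3 ⊢
        by_cases hs1 : s ∈ Set.Icc (((n : ℝ) + 1) * ε) ((n + 1 + 1) * ε)
        · exact h3 hs1
        · exact HasFDerivWithinAt.of_notMem_closure (by rwa [isClosed_Icc.closure_eq])
  obtain ⟨n, hn⟩ := exists_nat_gt (t / ε)
  rw [div_lt_iff₀ hε] at hn
  have hlt : t < (n + 1) * ε := by nlinarith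
  refine (hIcc n t ⟨ht, hlt.le⟩).mono_of_mem_nhdsWithin ?_
  filter_upwards [self_mem_nhdsWithin, mem_nhdsWithin_of_mem_nhds (Iio_mem_nhds hlt)] with s hs hs'
  exact ⟨hs, le_of_lt hs'⟩

/-- **Global existence** for autonomous equations with a globally Lipschitz right-hand side. -/
theorem exists_forall_hasDerivWithinAt_Ici_of_lipschitzWith [CompleteSpace F] {f : F → F}
    {K : NNReal} (hf : LipschitzWith K f) (x₀ : F) :
    ∃ Z : ℝ → F, Z 0 = x₀ ∧ ∀ t, 0 ≤ t → HasDerivWithinAt Z (f (Z t)) (Set.Ici 0) t := by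
  -- This step length suits every starting point: on the ball of radius `‖f x‖ / (K + 1)` the field
  -- is at most `‖f x‖ (2 K + 1) / (K + 1)`, so the solution cannot leave it within time `ε`.
  set ε : ℝ := 1 / (2 * (K + 1)) with hεdef
  have hε : 0 < ε := by positivity
  have hloc : ∀ x : F, ∃ α : ℝ → F, α 0 = x ∧
      ∀ t ∈ Set.Icc 0 ε, HasDerivWithinAt α (f (α t)) (Set.Icc 0 ε) t := by
    intro x
    have hpl : IsPicardLindelof (fun _ => f) (tmin := 0) (tmax := ε) ⟨0, le_rfl, hε.le⟩ x
        (‖f x‖₊ / (K + 1)) 0 (‖f x‖₊ + K * (‖f x‖₊ / (K + 1))) K := by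
      refine IsPicardLindelof.of_time_independent (fun y hy => ?_) hf.lipschitzOnWith ?_
      · have h1 := hf.dist_le_mul y x
        rw [dist_eq_norm] at h1
        have h2 := norm_le_norm_add_norm_sub' (f y) (f x)
        push_cast
        rw [Metric.mem_closedBall] at hy
        push_cast at hy
        have := mul_le_mul_of_nonneg_left hy K.coe_nonneg
        linarith
      · simp only [sub_zero, sub_self, NNReal.coe_zero]
        rw [max_eq_left hε.le]
        push_cast
        have hK : (0 : ℝ) < K + 1 := by positivity
        rw [hεdef]
        have h0 : 0 ≤ ‖f x‖ := norm_nonneg _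
        have hK0 := K.coe_nonneg
        field_simp
        nlinarith [mul_nonneg h0 hK0]
    exact hpl.exists_eq_forall_mem_Icc_hasDerivWithinAt₀
  choose α hα0 hα using hloc
  let x : ℕ → F := fun n => Nat.rec x₀ (fun _ y => α y ε) n
  have hx : ∀ n, x (n + 1) = α (x n) ε := fun n => rfl
  let Z : ℝ → F := fun t => α (x ⌊t / ε⌋₊) (t - ⌊t / ε⌋₊ * ε)
  have hZ : ∀ n : ℕ, ∀ t ∈ Set.Icc (n * ε) ((n + 1) * ε), Z t = α (x n) (t - n * ε) := by
    intro n t ht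
    -- At the right endpoint the floor is already `n + 1`; the two pieces agree there.
    rcases ht.2.eq_or_lt with h | h
    · have hfl : ⌊t / ε⌋₊ = n + 1 := by
        rw [h, mul_div_assoc, div_self hε.ne', mul_one]
        exact_mod_cast Nat.floor_natCast (n + 1)
      have h1 : t - ((n + 1 : ℕ) : ℝ) * ε = 0 := by rw [h]; push_cast; ring
      have h2 : t - n * ε = ε := by rw [h]; ring
      simp only [Z, hfl]
      rw [h1, h2, hα0, hx]
    · have hfl : ⌊t / ε⌋₊ = n := by
        have h0 : 0 ≤ t := le_trans (by positivity) ht.1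
        rw [Nat.floor_eq_iff (by positivity), le_div_iff₀ hε, div_lt_iff₀ hε]
        exact ⟨ht.1, h⟩
      simp only [Z, hfl]
  refine ⟨Z, ?_, fun t ht => hasDerivWithinAt_Ici_of_forall_Icc hε (fun n s hs => ?_) ht⟩
  · rw [hZ 0 0 ⟨by simp, by simpa using hε.le⟩]
    simp [hα0, x]
  · have hs' : s - n * ε ∈ Set.Icc 0 ε := ⟨by linarith [hs.1], by linarith [hs.2]⟩
    have h1 := hα (x n) _ hs'
    have h2 : HasDerivWithinAt (fun r => α (x n) (r - n * ε)) (f (α (x n) (s - n * ε)))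
        (Set.Icc (n * ε) ((n + 1) * ε)) s := by
      have := HasDerivWithinAt.scomp (t' := Set.Icc 0 ε) s h1
        ((hasDerivWithinAt_id s (Set.Icc (n * ε) ((n + 1) * ε))).sub_const (n * ε))
        (fun r hr => ⟨by simpa using hr.1, by
          have := hr.2
          simp only [id]
          linarith⟩)
      simpa [Function.comp_def] using this
    rw [← hZ n s hs] at h2
    exact h2.congr (hZ n) (hZ n s hs)

end GlobalExistence

/-! ### From a discrete contraction to an exponential rate. -/

section Decay

/-- A nonnegative function that decreases by a fixed factor over unit time decays exponentially. -/
theorem le_exp_of_mul_le {d : ℝ → ℝ} {c : ℝ} (hc : 0 < c) (hd : ∀ t, 0 ≤ t → 0 ≤ d t)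
    (h : ∀ s t, 0 ≤ s → s ≤ t → d t * (1 + c * (t - s)) ≤ d s) {t : ℝ} (ht : 0 ≤ t) :
    d t ≤ (1 + c) * d 0 * Real.exp (-(Real.log (1 + c) * t)) := by
  have h1c : 0 < 1 + c := by linarith
  have hn : ∀ n : ℕ, d n * (1 + c) ^ n ≤ d 0 := by
    intro n
    induction n with
    | zero => simp
    | succ n ih =>
      have := h n (n + 1) (by positivity) (by linarith)
      rw [add_sub_cancel_left, mul_one] at this
      push_cast
      rw [pow_succ']
      calc d (n + 1) * ((1 + c) * (1 + c) ^ n) = d (n + 1) * (1 + c) * (1 + c) ^ n := by ring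
        _ ≤ d n * (1 + c) ^ n := by gcongr
        _ ≤ d 0 := ih
  have hfl := Nat.floor_le ht
  have h1 : d t ≤ d ⌊t⌋₊ := by
    refine le_trans ?_ (h ⌊t⌋₊ t (by positivity) hfl)
    have := mul_nonneg (hd t ht) (mul_nonneg hc.le (sub_nonneg.2 hfl))
    linarith
  -- Rounding `t` down to an integer costs one factor `1 + c`.
  have h2 : (1 + c) ^ t ≤ (1 + c) * (1 + c) ^ ⌊t⌋₊ := by
    rw [← pow_succ', ← Real.rpow_natCast]
    refine Real.rpow_le_rpow_of_exponent_le (by linarith) ?_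
    push_cast
    exact (Nat.lt_floor_add_one t).le
  have h3 : Real.exp (-(Real.log (1 + c) * t)) = ((1 + c) ^ t)⁻¹ := by
    rw [Real.exp_neg, Real.rpow_def_of_pos h1c]
  have h4 : 0 < (1 + c) ^ t := Real.rpow_pos_of_pos h1c t
  rw [h3, ← div_eq_mul_inv, le_div_iff₀ h4]
  calc d t * (1 + c) ^ t ≤ d ⌊t⌋₊ * ((1 + c) * (1 + c) ^ ⌊t⌋₊) :=
        mul_le_mul h1 h2 h4.le (hd _ (by positivity))
    _ = (1 + c) * (d ⌊t⌋₊ * (1 + c) ^ ⌊t⌋₊) := by ring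
    _ ≤ (1 + c) * d 0 := by gcongr; exact hn _

end Decay

/-! ### Lyapunov analysis of the dynamics. -/

noncomputable section

section Convergence

variable {ι : Type*} [Fintype ι]

theorem HasDerivWithinAt.dotProduct_pi {x y : ℝ → ι → ℝ} {x' y' : ι → ℝ} {s : Set ℝ} {t : ℝ}
    (hx : HasDerivWithinAt x x' s t) (hy : HasDerivWithinAt y y' s t) :
    HasDerivWithinAt (fun r => x r ⬝ᵥ y r) (x' ⬝ᵥ y t + x t ⬝ᵥ y') s t := by
  rw [hasDerivWithinAt_pi] at hx hy
  simp only [_root_.dotProduct, ← Finset.sum_add_distrib]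
  exact HasDerivWithinAt.fun_sum fun i _ => (hx i).mul (hy i)

theorem HasDerivWithinAt.mulVec_pi {x : ℝ → ι → ℝ} {x' : ι → ℝ} {s : Set ℝ} {t : ℝ}
    (A : Matrix ι ι ℝ) (hx : HasDerivWithinAt x x' s t) :
    HasDerivWithinAt (fun r => A *ᵥ x r) (A *ᵥ x') s t :=
  (LinearMap.toContinuousLinearMap A.mulVecLin).hasFDerivAt.comp_hasDerivWithinAt t hx

theorem Matrix.PosDef.dotProduct_mulVec_pos_of_ne_zero {A : Matrix ι ι ℝ} (hA : A.PosDef) {x : ι → ℝ}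
    (hx : x ≠ 0) : 0 < x ⬝ᵥ (A *ᵥ x) := by
  simpa using hA.dotProduct_mulVec_pos hx

theorem Matrix.PosDef.dotProduct_mulVec_comm {A : Matrix ι ι ℝ} (hA : A.PosDef) (x y : ι → ℝ) :
    x ⬝ᵥ (A *ᵥ y) = y ⬝ᵥ (A *ᵥ x) := by
  have : Aᵀ = A := by simpa [Matrix.IsHermitian] using hA.isHermitian
  rw [dotProduct_mulVec, ← mulVec_transpose, this, dotProduct_comm]

/-- The quadratic form of a positive definite matrix is equivalent to the square of the norm. -/
theorem Matrix.PosDef.exists_bounds {A : Matrix ι ι ℝ} (hA : A.PosDef) :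
    ∃ m M : ℝ, 0 < m ∧ 0 < M ∧ ∀ x, m * (x ⬝ᵥ x) ≤ x ⬝ᵥ (A *ᵥ x) ∧
      x ⬝ᵥ (A *ᵥ x) ≤ M * (x ⬝ᵥ x) := by
  have hcont : Continuous fun x : ι → ℝ => x ⬝ᵥ (A *ᵥ x) := by fun_prop
  let s : Set (ι → ℝ) := {x | x ⬝ᵥ x = 1}
  have hs : IsCompact s := by
    refine IsCompact.of_isClosed_subset (isCompact_Icc (a := (-1 : ι → ℝ)) (b := 1))
      (isClosed_eq (by fun_prop) continuous_const) fun x hx => ?_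
    have h1 : ∀ i, |x i| ≤ 1 := fun i => by
      rw [← sq_le_one_iff_abs_le_one, sq, ← (show x ⬝ᵥ x = 1 from hx)]
      exact ThrustAllocation.sq_apply_le_dotProduct_self x i
    exact ⟨fun i => (abs_le.1 (h1 i)).1, fun i => (abs_le.1 (h1 i)).2⟩
  obtain ⟨m, M, hm, hM, hb⟩ : ∃ m M : ℝ, 0 < m ∧ 0 < M ∧ ∀ x ∈ s, m ≤ x ⬝ᵥ (A *ᵥ x) ∧
      x ⬝ᵥ (A *ᵥ x) ≤ M := by
    -- The unit sphere is empty when `ι` is; otherwise compactness gives the extrema, and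
    -- homogeneity extends them to all vectors.
    rcases s.eq_empty_or_nonempty with h | h
    · exact ⟨1, 1, one_pos, one_pos, by simp [h]⟩
    obtain ⟨y, hy, hmin⟩ := hs.exists_isMinOn h hcont.continuousOn
    obtain ⟨z, hz, hmax⟩ := hs.exists_isMaxOn h hcont.continuousOn
    have hpos : ∀ x ∈ s, 0 < x ⬝ᵥ (A *ᵥ x) := fun x hx =>
      hA.dotProduct_mulVec_pos_of_ne_zero fun h0 => by simp [s, h0] at hx
    exact ⟨_, _, hpos y hy, hpos z hz, fun x hx => ⟨hmin hx, hmax hx⟩⟩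
  refine ⟨m, M, hm, hM, fun x => ?_⟩
  by_cases hx : x = 0
  · simp [hx]
  have hpos : 0 < x ⬝ᵥ x := lt_of_le_of_ne (Finset.sum_nonneg fun i _ => mul_self_nonneg (x i))
    fun h => hx (dotProduct_self_eq_zero.1 h.symm)
  have hsq : Real.sqrt (x ⬝ᵥ x) * Real.sqrt (x ⬝ᵥ x) = x ⬝ᵥ x := Real.mul_self_sqrt hpos.le
  have hsp := Real.sqrt_pos.2 hpos
  have h1 := hb ((Real.sqrt (x ⬝ᵥ x))⁻¹ • x) (by
    simp only [s, Set.mem_ofPred_eq, smul_dotProduct, dotProduct_smul, smul_eq_mul]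
    field_simp
    rw [sq, hsq])
  simp only [mulVec_smul, smul_dotProduct, dotProduct_smul, smul_eq_mul, ← mul_assoc,
    ← mul_inv, hsq] at h1
  rw [inv_mul_eq_div, le_div_iff₀ hpos, div_le_iff₀ hpos] at h1
  exact h1

namespace ThrustAllocation

variable [DecidableEq ι] {lo hi : ι → ℝ} {E Γ : Matrix ι ι ℝ} {S : ι → ℝ} {Z : ℝ → ι → ℝ}

/-- The weight `Γ⁻¹` cancels `Γ`, and transposing `1 + Eᵀ` produces exactly the pairing estimated by
`projResidual_dotProduct_le`. -/
theorem hasDerivWithinAt_energy (hΓ : Γ.PosDef) {t : ℝ} {T : Set ℝ}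
    (hZ : HasDerivWithinAt Z ((Γ * (1 + Eᵀ)) *ᵥ projResidual lo hi E S (Z t)) T t) (w : ι → ℝ) :
    HasDerivWithinAt (fun r => (Z r - w) ⬝ᵥ (Γ⁻¹ *ᵥ (Z r - w)))
      (2 * (((Z t - w) + E *ᵥ (Z t - w)) ⬝ᵥ projResidual lo hi E S (Z t))) T t := by
  have h1 := hZ.sub_const w
  refine (h1.dotProduct_pi (h1.mulVec_pi Γ⁻¹)).congr_deriv ?_
  have hdet : IsUnit Γ.det := (Matrix.isUnit_iff_isUnit_det Γ).1 hΓ.isUnit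
  rw [hΓ.inv.dotProduct_mulVec_comm _ (Z t - w), mulVec_mulVec, ← Matrix.mul_assoc,
    Matrix.nonsing_inv_mul _ hdet, Matrix.one_mul, add_mulVec, one_mulVec, dotProduct_add,
    dotProduct_mulVec _ Eᵀ, vecMul_transpose, add_dotProduct]
  ring

/-- The energy plus `c r` has nonpositive derivative on `(s, t)`. The integrated form is what passes
to an infimum over `w`. -/
theorem energy_add_mul_le (h : lo ≤ hi) (hE : ∀ x, 0 ≤ x ⬝ᵥ (E *ᵥ x)) (hΓ : Γ.PosDef)
    (hZ : ∀ t, 0 ≤ t → HasDerivWithinAt Z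
      ((Γ * (1 + Eᵀ)) *ᵥ projResidual lo hi E S (Z t)) (Set.Ici 0) t)
    {w : ι → ℝ} (hw : projResidual lo hi E S w = 0) {c s t : ℝ} (hs : 0 ≤ s) (hst : s ≤ t)
    (hc : ∀ r, s ≤ r → r ≤ t →
      c ≤ 2 * (projResidual lo hi E S (Z r) ⬝ᵥ projResidual lo hi E S (Z r))) :
    (Z t - w) ⬝ᵥ (Γ⁻¹ *ᵥ (Z t - w)) + c * (t - s) ≤ (Z s - w) ⬝ᵥ (Γ⁻¹ *ᵥ (Z s - w)) := by
  have hd : ∀ r, 0 ≤ r → HasDerivWithinAt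
      (fun r => (Z r - w) ⬝ᵥ (Γ⁻¹ *ᵥ (Z r - w)) + c * r)
      (2 * (((Z r - w) + E *ᵥ (Z r - w)) ⬝ᵥ projResidual lo hi E S (Z r)) + c) (Set.Ici 0) r :=
    fun r hr => (hasDerivWithinAt_energy hΓ (hZ r hr) w).add
      (by simpa using (hasDerivWithinAt_id r (Set.Ici 0)).const_mul c)
  have hd' : ∀ r ∈ Set.Ioo s t, HasDerivAt
      (fun r => (Z r - w) ⬝ᵥ (Γ⁻¹ *ᵥ (Z r - w)) + c * r)
      (2 * (((Z r - w) + E *ᵥ (Z r - w)) ⬝ᵥ projResidual lo hi E S (Z r)) + c) r :=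
    fun r hr => (hd r (hs.trans hr.1.le)).hasDerivAt (Ici_mem_nhds (hs.trans_lt hr.1))
  have hanti : AntitoneOn (fun r => (Z r - w) ⬝ᵥ (Γ⁻¹ *ᵥ (Z r - w)) + c * r) (Set.Icc s t) := by
    refine antitoneOn_of_deriv_nonpos (convex_Icc s t)
      (fun r hr => ((hd r (hs.trans hr.1)).continuousWithinAt).mono
        fun q hq => hs.trans hq.1) ?_ ?_
    · rw [interior_Icc]
      exact fun r hr => (hd' r hr).differentiableAt.differentiableWithinAt
    · rw [interior_Icc]
      intro r hr
      rw [(hd' r hr).deriv]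
      have h1 := projResidual_dotProduct_le h E S (Z r) w hw
      have h2 := hc r hr.1.le hr.2.le
      have h3 := hE (Z r - w)
      linarith
  have := hanti (Set.left_mem_Icc.2 hst) (Set.right_mem_Icc.2 hst) hst
  simp only at this
  linarith

/-- Solutions of the projected primal-dual dynamics approach the solution set of the variational
inequality exponentially. -/
theorem exists_exponential_bound (h : lo ≤ hi) (hE : ∀ x, 0 ≤ x ⬝ᵥ (E *ᵥ x))
    (hne : ∃ w, projResidual lo hi E S w = 0) (hΓ : Γ.PosDef) :
    ∃ C : ℝ, 0 < C ∧ ∃ rate : ℝ, 0 < rate ∧ ∀ Z : ℝ → ι → ℝ,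
      (∀ t, 0 ≤ t → HasDerivWithinAt Z
        ((Γ * (1 + Eᵀ)) *ᵥ projResidual lo hi E S (Z t)) (Set.Ici 0) t) →
      ∀ w, projResidual lo hi E S w = 0 → ∀ t, 0 ≤ t → ∀ q : ℝ,
        (∀ w, projResidual lo hi E S w = 0 → q ≤ (Z t - w) ⬝ᵥ (Z t - w)) →
        q ≤ C * ((Z 0 - w) ⬝ᵥ (Z 0 - w)) * Real.exp (-(rate * t)) := by
  obtain ⟨m, M, hm, hM, hb⟩ := hΓ.inv.exists_bounds
  obtain ⟨κ, hκ, hbound⟩ := exists_error_bound E S h hne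
  -- The energy of the nearby solution given by the error bound is at most `M κ |e|²`.
  set c : ℝ := 1 / (M * κ) with hc
  have hc0 : 0 < c := by positivity
  refine ⟨(1 + c) * M / m, by positivity, Real.log (1 + c), Real.log_pos (by linarith),
    fun Z hZ w hw t ht q hq => ?_⟩
  let X := {w : ι → ℝ // projResidual lo hi E S w = 0}
  have : Nonempty X := ⟨⟨w, hw⟩⟩
  let φ : ℝ → X → ℝ := fun t w => (Z t - w.1) ⬝ᵥ (Γ⁻¹ *ᵥ (Z t - w.1))
  have hφ0 : ∀ t w, 0 ≤ φ t w := fun t w => le_trans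
    (mul_nonneg hm.le (Finset.sum_nonneg fun i _ => mul_self_nonneg _)) (hb _).1
  have hbdd : ∀ t, BddBelow (Set.range (φ t)) := fun t =>
    ⟨0, by rintro _ ⟨w, rfl⟩; exact hφ0 t w⟩
  -- Taking the infimum over all solutions avoids differentiating the distance to a set.
  let d : ℝ → ℝ := fun t => ⨅ w, φ t w
  have hd0 : ∀ t, 0 ≤ d t := fun t => le_ciInf (hφ0 t)
  have hanti : ∀ s t, 0 ≤ s → s ≤ t → d t ≤ d s := by
    intro s t hs hst
    refine le_ciInf fun w => (ciInf_le (hbdd t) w).trans ?_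
    have := energy_add_mul_le (c := 0) h hE hΓ hZ w.2 hs hst fun r _ _ =>
      mul_nonneg two_pos.le (Finset.sum_nonneg fun i _ => mul_self_nonneg _)
    rwa [zero_mul, add_zero] at this
  have hres : ∀ r, c * d r ≤ 2 * (projResidual lo hi E S (Z r) ⬝ᵥ projResidual lo hi E S (Z r)) := by
    intro r
    obtain ⟨v, hv, hle⟩ := hbound (Z r)
    have h1 : d r ≤ φ r ⟨v, hv⟩ := ciInf_le (hbdd r) _
    have h2 : φ r ⟨v, hv⟩ ≤ M * ((Z r - v) ⬝ᵥ (Z r - v)) := (hb _).2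
    have h3 := mul_le_mul_of_nonneg_left hle hM.le
    have h4 : 0 ≤ projResidual lo hi E S (Z r) ⬝ᵥ projResidual lo hi E S (Z r) :=
      Finset.sum_nonneg fun i _ => mul_self_nonneg _
    rw [hc, one_div, inv_mul_le_iff₀ (by positivity)]
    have h5 := mul_nonneg (mul_nonneg hM.le hκ.le) h4
    linarith
  have hstep : ∀ s t, 0 ≤ s → s ≤ t → d t * (1 + c * (t - s)) ≤ d s := by
    intro s t hs hst
    refine le_ciInf fun w => ?_
    -- As `d` is nonincreasing, `c * d t` bounds the dissipation from below on all of `[s, t]`.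
    have h1 := energy_add_mul_le (c := c * d t) h hE hΓ hZ w.2 hs hst fun r hsr hrt =>
      (mul_le_mul_of_nonneg_left (hanti r t (hs.trans hsr) hrt) hc0.le).trans (hres r)
    have h2 : d t ≤ φ t w := ciInf_le (hbdd t) w
    simp only [φ] at h2 ⊢
    linarith
  have hdecay := le_exp_of_mul_le hc0 (fun t _ => hd0 t) hstep ht
  have hqd : m * q ≤ d t := le_ciInf fun v =>
    (mul_le_mul_of_nonneg_left (hq v.1 v.2) hm.le).trans (hb _).1
  have hd0w : d 0 ≤ M * ((Z 0 - w) ⬝ᵥ (Z 0 - w)) :=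
    (ciInf_le (hbdd 0) (⟨w, hw⟩ : X)).trans (hb _).2
  have h1 : m * q ≤ (1 + c) * (M * ((Z 0 - w) ⬝ᵥ (Z 0 - w))) *
      Real.exp (-(Real.log (1 + c) * t)) := by
    refine hqd.trans (hdecay.trans ?_)
    gcongr
  rw [← le_div_iff₀' hm] at h1
  refine h1.trans_eq ?_
  ring

end ThrustAllocation
end Convergence
end

/-! ### Optimality conditions of the program and the equilibria. -/

noncomputable section

/-- Multipliers for the first-order optimality condition on a polyhedron, in coordinates. -/
theorem exists_multiplier_dotProduct {ι J : Type*} [Fintype ι] [Fintype J] (a : J → ι → ℝ)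
    (b : J → ℝ) (g y : ι → ℝ) (hy : ∀ j, a j ⬝ᵥ y ≤ b j)
    (h : ∀ z : ι → ℝ, (∀ j, a j ⬝ᵥ z ≤ b j) → g ⬝ᵥ (z - y) ≤ 0) :
    ∃ m : J → ℝ, (∀ j, 0 ≤ m j) ∧ (∀ j, a j ⬝ᵥ y ≠ b j → m j = 0) ∧
      ∑ j, m j • a j = g := by
  have hin : ∀ x y : ι → ℝ, inner ℝ (WithLp.toLp 2 x : EuclideanSpace ℝ ι) (WithLp.toLp 2 y) =
      x ⬝ᵥ y := fun x y => by
    rw [EuclideanSpace.inner_toLp_toLp, dotProduct_comm]; simp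
  obtain ⟨m, hm, hact, hsum⟩ := exists_multiplier_of_forall_inner_nonpos
    (fun j => (WithLp.toLp 2 (a j) : EuclideanSpace ℝ ι)) b (WithLp.toLp 2 g) (WithLp.toLp 2 y)
    (fun j => (hin _ _).trans_le (hy j))
    (fun z hz => (hin g (z.ofLp - y)).trans_le
      (h z.ofLp fun j => (hin (a j) z.ofLp).symm.trans_le (hz j)))
  refine ⟨m, hm, fun j hj => hact j fun h' => hj ((hin _ _).symm.trans h'), ?_⟩
  have := congrArg WithLp.ofLp hsum
  simpa using this

theorem Matrix.PosDef.fromBlocks_zero {m n : Type*} [Fintype m] [Fintype n]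
    {A : Matrix m m ℝ} {B : Matrix n n ℝ} (hA : A.PosDef) (hB : B.PosDef) :
    (fromBlocks A 0 0 B).PosDef := by
  rw [posDef_iff_dotProduct_mulVec]
  refine ⟨?_, fun x hx => ?_⟩
  · rw [Matrix.isHermitian_fromBlocks_iff]
    exact ⟨hA.isHermitian, by simp, by simp, hB.isHermitian⟩
  · rw [star_trivial, fromBlocks_mulVec, ← Sum.elim_comp_inl_inr x]
    simp only [Sum.elim_comp_inl, Sum.elim_comp_inr, zero_mulVec, add_zero, zero_add,
      sumElim_dotProduct_sumElim]
    have hA0 : 0 ≤ (x ∘ Sum.inl) ⬝ᵥ (A *ᵥ (x ∘ Sum.inl)) := by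
      simpa using hA.posSemidef.dotProduct_mulVec_nonneg (x ∘ Sum.inl)
    have hB0 : 0 ≤ (x ∘ Sum.inr) ⬝ᵥ (B *ᵥ (x ∘ Sum.inr)) := by
      simpa using hB.posSemidef.dotProduct_mulVec_nonneg (x ∘ Sum.inr)
    by_cases h : x ∘ Sum.inl = 0
    · have h' : x ∘ Sum.inr ≠ 0 := by
        intro h'
        apply hx
        rw [← Sum.elim_comp_inl_inr x, h, h']
        ext (i | i) <;> rfl
      exact add_pos_of_nonneg_of_pos hA0 (hB.dotProduct_mulVec_pos_of_ne_zero h')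
    · exact add_pos_of_pos_of_nonneg (hA.dotProduct_mulVec_pos_of_ne_zero h) hB0

namespace ThrustAllocation

theorem euclNorm_sq {ι : Type*} [Fintype ι] (x : ι → ℝ) : euclNorm x ^ 2 = x ⬝ᵥ x := by
  rw [euclNorm, EuclideanSpace.norm_sq_eq]
  simp [dotProduct, sq]

namespace Data

variable {D : Data}

theorem posDef_K (hQ : D.Q.PosDef) (hP : D.P.PosDef) (hR : D.R.PosDef) : D.K.PosDef :=
  (hQ.smul two_pos).fromBlocks_zero ((hP.smul two_pos).fromBlocks_zero (hR.smul two_pos))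

theorem output_dotProduct_output_le (Z : ZIdx → ℝ) : output Z ⬝ᵥ output Z ≤ Z ⬝ᵥ Z := by
  simp only [dotProduct, output, Fintype.sum_sum_type (α₁ := UIdx)]
  exact le_add_of_nonneg_right (Finset.sum_nonneg fun i _ => mul_self_nonneg _)

/-- The off-diagonal blocks are skew and cancel: `E` is monotone, and definite only in the direction
of `U`. -/
theorem dotProduct_E_mulVec (Z : ZIdx → ℝ) :
    Z ⬝ᵥ (D.E *ᵥ Z) = output Z ⬝ᵥ (D.K *ᵥ output Z) := by
  have hZ : Z = Sum.elim (output Z) (Z ∘ Sum.inr) := (Sum.elim_comp_inl_inr Z).symm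
  rw [hZ, E, fromBlocks_mulVec]
  simp only [Sum.elim_comp_inl, Sum.elim_comp_inr, zero_mulVec, add_zero,
    sumElim_dotProduct_sumElim, neg_mulVec, dotProduct_add, dotProduct_neg]
  rw [mulVec_transpose, dotProduct_comm (output Z) (_ ᵥ* _), ← dotProduct_mulVec]
  change _ = output Z ⬝ᵥ (D.K *ᵥ output Z)
  ring

theorem isEquilibrium_iff {Vbar : Fin 3 → ℝ} {Z : ZIdx → ℝ} : D.IsEquilibrium Vbar Z ↔
    projResidual (Sum.elim D.ULo (-Vbar)) (Sum.elim D.UHi Vbar) D.E D.S Z = 0 :=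
  Iff.rfl

/-- Two solutions of the projection equation have the same output. -/
theorem IsEquilibrium.output_eq (hK : D.K.PosDef) {Vbar : Fin 3 → ℝ}
    (h : Sum.elim D.ULo (-Vbar) ≤ Sum.elim D.UHi Vbar) {Z w : ZIdx → ℝ}
    (hZ : D.IsEquilibrium Vbar Z) (hw : D.IsEquilibrium Vbar w) : output Z = output w := by
  have h1 := projResidual_dotProduct_le h D.E D.S Z w hw
  rw [isEquilibrium_iff.1 hZ, dotProduct_E_mulVec] at h1
  simp only [dotProduct_zero, zero_add, neg_zero] at h1
  by_contra hne
  have h2 : output (Z - w) ≠ 0 := fun h0 => hne (sub_eq_zero.1 h0)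
  exact absurd (hK.dotProduct_mulVec_pos_of_ne_zero h2) (not_lt.2 h1)

/-- The first-order optimality condition of the quadratic program. -/
theorem IsOptimal.gradient_nonneg (hK : D.K.PosDef) {U : UIdx → ℝ} (hU : D.IsOptimal U)
    {z : UIdx → ℝ} (hz : z ∈ D.feasible) : 0 ≤ (D.K *ᵥ U + D.W) ⬝ᵥ (z - U) := by
  set d := z - U with hd
  have hexp : ∀ t : ℝ, D.cost (U + t • d) = D.cost U + t * ((D.K *ᵥ U + D.W) ⬝ᵥ d) +
      t ^ 2 * (1 / 2 * (d ⬝ᵥ (D.K *ᵥ d))) := by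
    intro t
    simp only [cost, mulVec_add, mulVec_smul, add_dotProduct, dotProduct_add, smul_dotProduct,
      dotProduct_smul, smul_eq_mul]
    rw [hK.dotProduct_mulVec_comm U d, dotProduct_comm (D.K *ᵥ U) d]
    ring
  have hfeas : ∀ t : ℝ, 0 ≤ t → t ≤ 1 → U + t • d ∈ D.feasible := by
    intro t ht0 ht1
    refine ⟨?_, fun i => ?_⟩
    · rw [mulVec_add, mulVec_smul, hd, mulVec_sub, hz.1, hU.1.1, sub_self, smul_zero, add_zero]
    · have h1 := hz.2 i
      have h2 := hU.1.2 i
      simp only [hd, Pi.add_apply, Pi.smul_apply, Pi.sub_apply, smul_eq_mul]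
      constructor <;> nlinarith
  by_contra! hneg
  set p := (D.K *ᵥ U + D.W) ⬝ᵥ d
  set q := 1 / 2 * (d ⬝ᵥ (D.K *ᵥ d))
  have hpos : 0 < |q| - p := by linarith [abs_nonneg q]
  -- This step `t` lies in `(0, 1]` and satisfies `t * q < -p`, so `t p + t² q < 0` contradicts
  -- optimality.
  have ht0 : 0 < -p / (2 * (|q| - p)) := div_pos (by linarith) (by linarith)
  have ht1 : -p / (2 * (|q| - p)) ≤ 1 := by
    rw [div_le_one (by linarith)]
    linarith [abs_nonneg q]
  have hmin := hU.2 _ (hfeas _ ht0.le ht1)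
  rw [hexp] at hmin
  set t := -p / (2 * (|q| - p)) with ht
  have htq : t * q < -p := by
    have h1 : t * (2 * (|q| - p)) = -p := by rw [ht]; field_simp
    nlinarith [le_abs_self q, abs_nonneg q]
  nlinarith

/-- Lagrange multipliers of the quadratic program. -/
theorem IsOptimal.exists_multiplier (hK : D.K.PosDef) {U : UIdx → ℝ} (hU : D.IsOptimal U) :
    ∃ V : Fin 3 → ℝ, boxProj D.ULo D.UHi (U - (D.K *ᵥ U - D.Mᵀ *ᵥ V + D.W)) = U := by
  let p : UIdx → UIdx → ℝ := fun i => Pi.single i 1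
  have hp : ∀ i (x : UIdx → ℝ), p i ⬝ᵥ x = x i := fun i x => by simp [p]
  have hM : ∀ k (x : UIdx → ℝ), D.M k ⬝ᵥ x = (D.M *ᵥ x) k := fun k x => rfl
  -- The equality `M U = Y` enters as two opposite inequalities; `V` is the difference of their
  -- multipliers.
  let a : (Fin 3 ⊕ Fin 3) ⊕ (UIdx ⊕ UIdx) → UIdx → ℝ :=
    Sum.elim (Sum.elim (fun k => D.M k) (fun k => -D.M k)) (Sum.elim (fun i => -p i) p)
  let b : (Fin 3 ⊕ Fin 3) ⊕ (UIdx ⊕ UIdx) → ℝ :=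
    Sum.elim (Sum.elim D.Y (-D.Y)) (Sum.elim (-D.ULo) D.UHi)
  have hfeas : ∀ z, (∀ j, a j ⬝ᵥ z ≤ b j) ↔ z ∈ D.feasible := by
    intro z
    simp only [a, b, Sum.forall, Sum.elim_inl, Sum.elim_inr, neg_dotProduct, hM, hp, Pi.neg_apply,
      neg_le_neg_iff, feasible, box, Set.mem_ofPred_eq, le_antisymm_iff, Pi.le_def, forall_and]
  obtain ⟨m, hm, hact, hsum⟩ := exists_multiplier_dotProduct a b (-(D.K *ᵥ U + D.W)) U
    ((hfeas U).2 hU.1) fun z hz => by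
      rw [neg_dotProduct, neg_nonpos]
      exact hU.gradient_nonneg hK ((hfeas z).1 hz)
  refine ⟨fun k => m (.inl (.inr k)) - m (.inl (.inl k)), funext fun i => ?_⟩
  have hi := congrFun hsum i
  have hlo := hact (.inr (.inl i))
  have hhi := hact (.inr (.inr i))
  have hlo0 := hm (.inr (.inl i))
  have hhi0 := hm (.inr (.inr i))
  have hbox := hU.1.2 i
  simp only [Finset.sum_apply, Pi.smul_apply, smul_eq_mul, Fintype.sum_sum_type (α₁ := Fin 3 ⊕ Fin 3),
    Fintype.sum_sum_type (α₁ := Fin 3), Fintype.sum_sum_type (α₁ := UIdx), a, b, Sum.elim_inl,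
    Sum.elim_inr, Pi.neg_apply, Pi.add_apply, p, neg_dotProduct] at hi hlo hhi
  simp only [single_dotProduct, one_mul, Pi.single_apply, mul_neg, mul_ite, mul_one, mul_zero,
    Finset.sum_neg_distrib, Finset.sum_ite_eq, Finset.mem_univ, if_true] at hi hlo hhi
  have hMV : (D.Mᵀ *ᵥ fun k => m (.inl (.inr k)) - m (.inl (.inl k))) i =
      ∑ k, m (.inl (.inr k)) * D.M k i - ∑ k, m (.inl (.inl k)) * D.M k i := by
    simp only [mulVec, dotProduct, transpose_apply, ← Finset.sum_sub_distrib]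
    exact Finset.sum_congr rfl fun k _ => by ring
  have hx : (U - ((D.K *ᵥ U - D.Mᵀ *ᵥ fun k => m (.inl (.inr k)) - m (.inl (.inl k))) + D.W)) i =
      U i - m (.inr (.inl i)) + m (.inr (.inr i)) := by
    simp only [Pi.sub_apply, Pi.add_apply, hMV]
    linarith
  have hlo' : D.ULo i < U i → m (.inr (.inl i)) = 0 := fun h =>
    hlo fun h' => h.ne (neg_injective h').symm
  have hhi' : U i < D.UHi i → m (.inr (.inr i)) = 0 := fun h => hhi h.ne
  unfold boxProj
  rw [hx]
  -- Complementary slackness: a bound's multiplier pushes the argument past that bound only where it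
  -- is active, and the projection returns it to `U i`.
  rcases hbox.1.eq_or_lt with h1 | h1 <;> rcases hbox.2.eq_or_lt with h2 | h2
  · split_ifs <;> linarith
  · rw [hhi' h2]
    split_ifs <;> linarith
  · rw [hlo' h1]
    split_ifs <;> linarith
  · rw [hlo' h1, hhi' h2]
    split_ifs <;> linarith

/-- Since `M U = Y`, the dual argument of the projection is `V` itself, which is fixed as soon as it
lies in the box. -/
theorem IsOptimal.isEquilibrium {U : UIdx → ℝ} (hU : D.IsOptimal U) {V Vbar : Fin 3 → ℝ}
    (hV : boxProj D.ULo D.UHi (U - (D.K *ᵥ U - D.Mᵀ *ᵥ V + D.W)) = U)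
    (hVbar : |V| ≤ Vbar) : D.IsEquilibrium Vbar (Sum.elim U V) := by
  rw [IsEquilibrium, sub_eq_zero, G, E, S, fromBlocks_mulVec]
  simp only [Sum.elim_comp_inl, Sum.elim_comp_inr, zero_mulVec, add_zero, neg_mulVec]
  ext (i | k)
  · exact congrFun hV i
  · have h1 := abs_le.1 (hVbar k)
    have h2 := congrFun hU.1.1 k
    simp only [boxProj, Pi.sub_apply, Pi.add_apply, Sum.elim_inr, Pi.neg_apply, h2,
      add_neg_cancel, sub_zero]
    rw [if_neg (not_lt.2 h1.1), if_neg (not_lt.2 h1.2)]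

end Data

end ThrustAllocation

end

/-! ### Assembly of the convergence theorem. -/

theorem theorem1 (D : ThrustAllocation.Data)
    (hQ : D.Q.PosDef) (hP : D.P.PosDef) (hR : D.R.PosDef)
    (Ustar : ThrustAllocation.UIdx → ℝ) (hU : D.IsOptimal Ustar) :
    ∃ V0 : Fin 3 → ℝ, ∀ Vbar : Fin 3 → ℝ, V0 ≤ Vbar →
      (∃ Zs : ThrustAllocation.ZIdx → ℝ, D.IsEquilibrium Vbar Zs) ∧
      ∀ Γ : Matrix ThrustAllocation.ZIdx ThrustAllocation.ZIdx ℝ, Γ.PosDef →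
        (∀ Z0 : ThrustAllocation.ZIdx → ℝ,
          ∃ Z : ℝ → ThrustAllocation.ZIdx → ℝ, D.IsTrajectory Vbar Γ Z ∧ Z 0 = Z0) ∧
        ∃ C : ℝ, 0 < C ∧ ∃ rate : ℝ, 0 < rate ∧
          ∀ Z : ℝ → ThrustAllocation.ZIdx → ℝ, D.IsTrajectory Vbar Γ Z →
            ∀ Zs : ThrustAllocation.ZIdx → ℝ, D.IsEquilibrium Vbar Zs →
              ∀ t : ℝ, 0 ≤ t →
                ThrustAllocation.euclNorm (ThrustAllocation.output (Z t) - Ustar) ≤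
                  C * ThrustAllocation.euclNorm (Z 0 - Zs) * Real.exp (-(rate * t)) := by
  have hK := ThrustAllocation.Data.posDef_K hQ hP hR
  obtain ⟨V, hV⟩ := hU.exists_multiplier hK
  refine ⟨|V|, fun Vbar hVbar => ?_⟩
  have hs := hU.isEquilibrium hV hVbar
  have hbox : Sum.elim D.ULo (-Vbar) ≤ Sum.elim D.UHi Vbar := by
    rintro (i | k)
    · exact (hU.1.2 i).1.trans (hU.1.2 i).2
    · have := (abs_nonneg (V k)).trans (hVbar k)
      simp only [Sum.elim_inr, Pi.neg_apply]
      linarith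
  refine ⟨⟨_, hs⟩, fun Γ hΓ => ⟨fun Z0 => ?_, ?_⟩⟩
  · obtain ⟨L, hL⟩ := ThrustAllocation.exists_lipschitzWith_projResidual hbox D.E D.S
    obtain ⟨Z, hZ0, hZ⟩ := exists_forall_hasDerivWithinAt_Ici_of_lipschitzWith
      ((LinearMap.toContinuousLinearMap (Γ * (1 + D.Eᵀ)).mulVecLin).lipschitz.comp hL) Z0
    exact ⟨Z, hZ, hZ0⟩
  · have hE : ∀ x, 0 ≤ x ⬝ᵥ (D.E *ᵥ x) := fun x => by
      rw [ThrustAllocation.Data.dotProduct_E_mulVec]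
      simpa using hK.posSemidef.dotProduct_mulVec_nonneg (ThrustAllocation.output x)
    obtain ⟨C, hC, rate, hrate, hbound⟩ :=
      ThrustAllocation.exists_exponential_bound hbox hE ⟨_, hs⟩ hΓ
    -- The bound available is for squared norms, hence the square root and the halved rate.
    refine ⟨Real.sqrt C, Real.sqrt_pos.2 hC, rate / 2, half_pos hrate,
      fun Z hZ Zs hZs t ht => ?_⟩
    have h1 := hbound Z hZ Zs hZs t ht
      -- Every equilibrium has output `Ustar`, so this is at most the squared distance from `Z t` to
      -- each of them.
      ((ThrustAllocation.output (Z t) - Ustar) ⬝ᵥ (ThrustAllocation.output (Z t) - Ustar))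
      fun w hw => by
        have h2 : ThrustAllocation.output w = Ustar :=
          (ThrustAllocation.Data.IsEquilibrium.output_eq hK hbox hw hs).trans
            (Sum.elim_comp_inl Ustar V)
        rw [← h2]
        exact ThrustAllocation.Data.output_dotProduct_output_le (Z t - w)
    rw [← ThrustAllocation.euclNorm_sq, ← ThrustAllocation.euclNorm_sq] at h1
    refine le_of_sq_le_sq ?_ (by unfold ThrustAllocation.euclNorm; positivity)
    rw [mul_pow, mul_pow, Real.sq_sqrt hC.le, ← Real.exp_nat_mul]
    refine h1.trans_eq ?_
    congr 2
    push_cast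
    ring
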